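/- Let $R$ be a Cohen--Macaulay normal (noetherian) local ring with canonical module $\omega$ and maximal ideal $\mathfrak m$; all modules are finitely generated, and $(-)^*=\mathrm{Hom}_R(-,R)$. Let $h(R)$ be the Grothendieck group of finitely generated $R$-modules modulo the subgroup generated by the classes of pseudo-zero modules (those $M$ with $M_{\mathfrak p}=0$ for all primes $\mathfrak p$ of height $\le 1$). Let $k(R)$ be the kernel of the rank function $h(R)\to\mathbb Z$, and write $(-)_{\mathbb R}=(-)\otimes_{\mathbb Z}\mathbb R$. Suppose that $h(R)_{\mathbb R}=\mathbb R[R]\oplus k(R)_{\mathbb R}$ is finite-dimensional, with its Euclidean topology. Let $c(R)=\sum_M\mathbb R_{\ge0}[M]\subseteq h(R)_{\mathbb R}$, where $M$ runs over the maximal Cohen--Macaulay $R$-modules, that is, those with $\operatorname{depth}M_{\mathfrak p}\ge\operatorname{height}\mathfrak p$ for all primes $\mathfrak p$ (and $\operatorname{depth}0=\infty$). Let $\overline{c(R)}$ be its closure. Then: (1) $[R]$ and $[\omega]$ belong to the interior of $c(R)$. (2) $\overline{c(R)}$ is a strongly convex cone (a convex cone $C$ with $C\cap -C=\{0\}$)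 if and only if $\overline{c(R)}\cap k(R)_{\mathbb R}=\{0\}$. (3) Suppose that $R$ is Gorenstein. Then $c(R)$ and $\overline{c(R)}$ are symmetric with respect to the axis $\mathbb R[R]$: for $a\in\mathbb R$ and $t\in k(R)_{\mathbb R}$, if $a[R]+t$ lies in the set, so does $a[R]-t$. If $M$ is a maximal Cohen--Macaulay $R$-module such that $[M]$ or $[M^*]$ belongs to the boundary of $c(R)$, then all syzygies and cosyzygies of $M$ have rank at least $\operatorname{rk}M$. (4) Without assuming that $R$ is Gorenstein: if $M$ is a totally reflexive $R$-module ($M$ is reflexive and $\mathrm{Ext}_R^i(M,R)=0=\mathrm{Ext}_R^i(M^*,R)$ for all $i>0$) such that $[M]$ or $[M^*]$ belongs to the boundary of $c(R)$, then all syzygies and cosyzygies of $M$ have rank at least $\operatorname{rk}M$. Here the conclusion on syzygies and cosyzygies in (3) and (4) means the following: $M$ has a minimal complete resolution, that is, an exact sequence $\cdots\to F_1\xrightarrow{d_1}F_0\xrightarrow{d_0}F_{-1}\to\cdots$ of finitely generated free modules with exact $R$-dual, with $\operatorname{im}d_i\subseteq\mathfrak mF_{i-1}$ for all $i\in\mathbb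 Z$ and with $M\cong\operatorname{im}d_0$; and for every such sequence, $\operatorname{rk}(\operatorname{im}d_i)\ge\operatorname{rk}M$ for all $i\in\mathbb Z$ ($\operatorname{im}d_i$ is the $i$-th syzygy for $i\ge0$ and the $(-i)$-th cosyzygy for $i\le0$). -/

import Mathlib

open scoped TensorProduct
open CategoryTheory

universe u

namespace CMCone

noncomputable section

section GrothendieckGroups

variable (R : Type u) [CommRing R]

/-- The relations `[M₂] - [M₁] - [M₃]`, one for each short exact sequence
`0 → M₁ → M₂ → M₃ → 0` of finitely generated `R`-modules. -/
def exactRelations : Set (FreeAbelianGroup (FGModuleCat.{u} R)) :=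
  {x | ∃ (M₁ M₂ M₃ : FGModuleCat.{u} R) (f : M₁ →ₗ[R] M₂) (g : M₂ →ₗ[R] M₃),
    Function.Injective f ∧ Function.Exact f g ∧ Function.Surjective g ∧
    x = FreeAbelianGroup.of M₂ - FreeAbelianGroup.of M₁ - FreeAbelianGroup.of M₃}

/-- The Grothendieck group of the category of finitely generated `R`-modules. -/
abbrev G : Type (u + 1) :=
  FreeAbelianGroup (FGModuleCat.{u} R) ⧸ AddSubgroup.closure (exactRelations R)

/-- The class of a finitely generated module in the Grothendieck group. -/
def G.mk (M : FGModuleCat.{u} R) : G R :=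
  QuotientAddGroup.mk' (AddSubgroup.closure (exactRelations R)) (FreeAbelianGroup.of M)

/-- `M` is pseudo-zero: `M_𝔭 = 0` for all primes `𝔭` of height at most one. -/
def IsPseudoZero (M : Type u) [AddCommGroup M] [Module R M] : Prop :=
  ∀ p : PrimeSpectrum R, p.asIdeal.height ≤ 1 →
    Subsingleton (LocalizedModule p.asIdeal.primeCompl M)

/-- The subgroup of the Grothendieck group generated by the classes of pseudo-zero modules. -/
def pseudoZeroSubgroup : AddSubgroup (G R) :=
  AddSubgroup.closure {x | ∃ M : FGModuleCat.{u} R, IsPseudoZero R M ∧ x = G.mk R M}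

/-- The group `h(R)`: the Grothendieck group modulo pseudo-zero modules. -/
abbrev H : Type (u + 1) := G R ⧸ pseudoZeroSubgroup R

/-- The class of a finitely generated module in `h(R)`. -/
def H.mk (M : FGModuleCat.{u} R) : H R :=
  QuotientAddGroup.mk' (pseudoZeroSubgroup R) (G.mk R M)

/-- The real vector space `h(R)_ℝ = h(R) ⊗_ℤ ℝ`. -/
abbrev HR : Type (u + 1) := ℝ ⊗[ℤ] H R

/-- `h(R)_ℝ` carries the finest vector space topology. If `h(R)_ℝ` is finite-dimensional, this is
its unique Hausdorff vector space topology, that is, the topology of the Euclidean metric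
belonging to any choice of a basis. -/
instance : TopologicalSpace (HR R) := moduleTopology ℝ (HR R)

instance : IsModuleTopology ℝ (HR R) := ⟨rfl⟩

/-- The point `[M]` of `h(R)_ℝ`. -/
def cls (M : Type u) [AddCommGroup M] [Module R M] [Module.Finite R M] : HR R :=
  (1 : ℝ) ⊗ₜ[ℤ] H.mk R (FGModuleCat.of R M)

end GrothendieckGroups

section Rank

variable (R : Type u) [CommRing R] [IsDomain R]

theorem finrank_of_isPseudoZero (M : Type u) [AddCommGroup M] [Module R M]
    (h : IsPseudoZero R M) : Module.finrank R M = 0 := by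
  apply Module.IsTorsion.finrank_eq_zero
  have h0 := h ⟨⊥, Ideal.isPrime_bot⟩ (by simp)
  rw [LocalizedModule.subsingleton_iff] at h0
  intro x
  obtain ⟨r, hr, hrx⟩ := h0 x
  exact ⟨⟨r, mem_nonZeroDivisors_of_ne_zero (by simpa [Ideal.primeCompl] using hr)⟩, hrx⟩

theorem finrank_of_exact {M₁ M₂ M₃ : Type u} [AddCommGroup M₁] [AddCommGroup M₂] [AddCommGroup M₃]
    [Module R M₁] [Module R M₂] [Module R M₃] [Module.Finite R M₂]
    (f : M₁ →ₗ[R] M₂) (g : M₂ →ₗ[R] M₃) (hf : Function.Injective f) (hfg : Function.Exact f g)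
    (hg : Function.Surjective g) :
    Module.finrank R M₂ = Module.finrank R M₁ + Module.finrank R M₃ := by
  have h := Submodule.finrank_quotient_add_finrank (LinearMap.range f)
  rw [LinearMap.finrank_range_of_inj hf,
    (hfg.linearEquivOfSurjective hg).finrank_eq] at h
  omega

/-- The rank function on the Grothendieck group of a domain. -/
def G.rk : G R →+ ℤ :=
  QuotientAddGroup.lift _
    (FreeAbelianGroup.lift fun M : FGModuleCat.{u} R => (Module.finrank R M : ℤ)) (by
      rw [AddSubgroup.closure_le]
      rintro x ⟨M₁, M₂, M₃, f, g, hf, hfg, hg, rfl⟩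
      have h := finrank_of_exact R f g hf hfg hg
      simp only [SetLike.mem_coe, AddMonoidHom.mem_ker, map_sub, FreeAbelianGroup.lift_apply_of]
      omega)

/-- The rank function on `h(R)`, where `R` is a domain. -/
def H.rk : H R →+ ℤ :=
  QuotientAddGroup.lift _ (G.rk R) (by
    rw [pseudoZeroSubgroup, AddSubgroup.closure_le]
    rintro x ⟨M, hM, rfl⟩
    have h := finrank_of_isPseudoZero R M hM
    simp only [SetLike.mem_coe, AddMonoidHom.mem_ker]
    change FreeAbelianGroup.lift (fun M : FGModuleCat.{u} R => (Module.finrank R M : ℤ))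
      (FreeAbelianGroup.of M) = 0
    rw [FreeAbelianGroup.lift_apply_of]
    exact_mod_cast h)

/-- `k(R)`, the kernel of the rank function on `h(R)`. -/
def kZ : AddSubgroup (H R) := (H.rk R).ker

/-- The subspace `k(R)_ℝ` of `h(R)_ℝ`. -/
def kR : Submodule ℝ (HR R) :=
  (AddSubgroup.toIntSubmodule (kZ R)).baseChange ℝ

end Rank

section CohenMacaulay

open RingTheory.Sequence IsLocalRing

/-- The depth of a module over a local ring: the supremum of the lengths of the (weakly) regular
sequences in the maximal ideal. It is `⊤` for the zero module. For a nonzero finitely generated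
module, a weakly regular sequence in the maximal ideal is regular, by Nakayama's lemma. -/
def depth (S : Type u) [CommRing S] [IsLocalRing S] (N : Type u) [AddCommGroup N] [Module S N] :
    ℕ∞ :=
  ⨆ (rs : List S) (_ : (∀ r ∈ rs, r ∈ maximalIdeal S) ∧ IsWeaklyRegular N rs), (rs.length : ℕ∞)

/-- The (finitely generated) `R`-module `M` is maximal Cohen--Macaulay:
`depth M_𝔭 ≥ height 𝔭` for all primes `𝔭`. -/
def IsMCM (R : Type u) [CommRing R] (M : Type u) [AddCommGroup M] [Module R M] : Prop :=
  ∀ p : PrimeSpectrum R, p.asIdeal.height ≤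
    depth (Localization.AtPrime p.asIdeal) (LocalizedModule p.asIdeal.primeCompl M)

/-- The (noetherian) ring `R` is Cohen--Macaulay. -/
def IsCohenMacaulay (R : Type u) [CommRing R] : Prop := IsMCM R R

/-- `M` has finite injective dimension. -/
def FiniteInjDim (R : Type u) [CommRing R] (M : Type u) [AddCommGroup M] [Module R M] : Prop :=
  ∃ n : ℕ, HasInjectiveDimensionLE (ModuleCat.of R M) n

/-- The (noetherian) local ring `R` is Gorenstein. -/
def IsGorenstein (R : Type u) [CommRing R] : Prop := FiniteInjDim R R

/-- `ω` is a canonical module of the Cohen--Macaulay local ring `R`: a maximal Cohen--Macaulay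
module of finite injective dimension and of type one, the type of `ω` being the dimension of
`Ext^d(k, ω)` over the residue field `k`, where `d = depth ω`. -/
structure IsCanonicalModule (R : Type u) [CommRing R] [IsLocalRing R]
    (ω : Type u) [AddCommGroup ω] [Module R ω] : Prop where
  isMCM : IsMCM R ω
  finiteInjDim : FiniteInjDim R ω
  type_one : ∃ d : ℕ, depth R ω = d ∧
    Nonempty (Abelian.Ext (ModuleCat.of R (ResidueField R)) (ModuleCat.of R ω) d
      ≃ₗ[R] ResidueField R)

/-- The cone `c(R)` in `h(R)_ℝ` of all finite sums `∑ aᵢ [Mᵢ]` with real numbers `aᵢ ≥ 0` and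
maximal Cohen--Macaulay modules `Mᵢ`. -/
def c (R : Type u) [CommRing R] : PointedCone ℝ (HR R) :=
  PointedCone.hull ℝ {x | ∃ (M : Type u) (_ : AddCommGroup M) (_ : Module R M)
    (_ : Module.Finite R M), IsMCM R M ∧ x = cls R M}

end CohenMacaulay

section Convexity

/-- `C` is a convex cone. -/
def IsConvexCone {V : Type*} [AddCommGroup V] [Module ℝ V] (C : Set V) : Prop :=
  ∀ x ∈ C, ∀ y ∈ C, ∀ a b : ℝ, 0 ≤ a → 0 ≤ b → a • x + b • y ∈ C

/-- `C` is a strongly convex cone. -/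
def IsStronglyConvexCone {V : Type*} [AddCommGroup V] [Module ℝ V] (C : Set V) : Prop :=
  IsConvexCone C ∧ C ∩ {x | -x ∈ C} = {0}

/-- The set `C` of points of `h(R)_ℝ = ℝ[R] ⊕ k(R)_ℝ` is symmetric with respect to the
axis `ℝ[R]`: it is mapped into itself by the reflection that fixes the points of `ℝ[R]` and is
multiplication by `-1` on the orthogonal complement `k(R)_ℝ` of this axis. -/
def IsSymmetricAboutAxis (R : Type u) [CommRing R] [IsDomain R] (C : Set (HR R)) : Prop :=
  ∀ (a : ℝ), ∀ t ∈ kR R, a • cls R R + t ∈ C → a • cls R R - t ∈ C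

end Convexity

section TotallyReflexive

variable (R : Type u) [CommRing R] (M : Type u) [AddCommGroup M] [Module R M]

/-- `M` is totally reflexive: it is reflexive and `Ext^i(M, R) = 0 = Ext^i(M*, R)`
for all `i > 0`. -/
structure IsTotallyReflexive : Prop where
  isReflexive : Module.IsReflexive R M
  ext_eq_zero : ∀ i : ℕ, 0 < i →
    Subsingleton (Abelian.Ext (ModuleCat.of R M) (ModuleCat.of R R) i)
  ext_dual_eq_zero : ∀ i : ℕ, 0 < i →
    Subsingleton (Abelian.Ext (ModuleCat.of R (Module.Dual R M)) (ModuleCat.of R R) i)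

/-- A minimal complete resolution of `M` over the local ring `R`: an exact sequence
`⋯ → F₁ → F₀ → F₋₁ → ⋯` of finitely generated free modules, whose `R`-dual is exact too, such that
the image of each `Fᵢ₊₁ → Fᵢ` lies in `𝔪 Fᵢ` and `M` is isomorphic to the image of `F₀ → F₋₁`.
For a totally reflexive module without nonzero free direct summands it exists and is unique up to
isomorphism. Its part in degrees `≥ 0` is the minimal free resolution of `M`.
Here `Fᵢ` is the free module of rank `b i`, and `d i` is the map `Fᵢ₊₁ → Fᵢ`. -/
structure MinimalCompleteResolution [IsLocalRing R] where
  b : ℤ → ℕ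
  d : ∀ i : ℤ, (Fin (b (i + 1)) → R) →ₗ[R] (Fin (b i) → R)
  exact : ∀ i : ℤ, Function.Exact (d (i + 1)) (d i)
  dual_exact : ∀ i : ℤ, Function.Exact (d i).dualMap (d (i + 1)).dualMap
  minimal : ∀ i : ℤ, LinearMap.range (d i) ≤ IsLocalRing.maximalIdeal R • ⊤
  iso : M ≃ₗ[R] LinearMap.range (d (-1))

variable {R M} in
/-- The `i`-th syzygy of `M`, for any integer `i`: the image of `Fᵢ → Fᵢ₋₁`. For `i = -n < 0` this
is the `n`-th cosyzygy. -/
abbrev MinimalCompleteResolution.syz [IsLocalRing R] (F : MinimalCompleteResolution R M) (i : ℤ) :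
    Submodule R (Fin (F.b (i - 1)) → R) :=
  LinearMap.range (F.d (i - 1))

/-- All syzygies and cosyzygies of `M` have rank at least the rank of `M`: minimal complete
resolutions of `M` exist, and `rank (syz^i M) ≥ rank M` for all integers `i`, the syzygies
being formed with any such resolution. -/
def SyzygyRanksGE [IsLocalRing R] : Prop :=
  Nonempty (MinimalCompleteResolution R M) ∧
    ∀ (F : MinimalCompleteResolution R M) (i : ℤ), Module.finrank R M ≤ Module.finrank R (F.syz i)

end TotallyReflexive

end

end CMCone

/-!
A finitely generated torsion-free module `N` is free at the primes of height at most one, so a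
prime filtration of `N` shows that `[Hom(N, W)] = rk N · ([W] + rk W · [R]) - rk W · [N]` in
`h(R)_ℝ` for torsion-free `W`. The right-hand side is linear in `[N]`. If `W` is maximal
Cohen-Macaulay of finite injective dimension, then `Hom(-, W)` preserves maximal Cohen-Macaulay
modules, so this linear map preserves `c(R)`. It is `-rk W` on `k(R)_ℝ`, it maps `[R]` to `[W]`, and
its square is `(rk W)²`. For `W = ω` this gives the strong convexity criterion and moves the
interior point `[R]` to `[ω]`; for `W = R` it is the reflection in the axis `ℝ[R]`.

That `[R]` is an interior point follows from high syzygies being maximal Cohen-Macaulay: syzygies of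
both parities show that `a[R] ± [N]` lies in `c(R)` for some `a ≥ 0`, for every `N`. So `ε[R] + y`
is interior whenever `ε > 0` and `y ∈ c(R)`. In a complete resolution of `M`, the `k(R)_ℝ`-component
of each syzygy is `±` that of `M`, and that of `M*` is minus that of `M`. Hence a syzygy of rank
less than `rk M`, or its dual, exhibits `[M]` and `[M*]` in this form.
-/

namespace CMCone

/-! ### Short exact sequences and classes -/

section ShortExact

variable {R : Type*} [CommRing R] {A B C : Type*} [AddCommGroup A] [AddCommGroup B]
  [AddCommGroup C] [Module R A] [Module R B] [Module R C]

/-- The sequence `0 → A → B → C → 0` of modules, with maps `f` and `g`, is exact. -/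
structure IsShortExact (f : A →ₗ[R] B) (g : B →ₗ[R] C) : Prop where
  injective : Function.Injective f
  exact : Function.Exact f g
  surjective : Function.Surjective g

theorem isShortExact_subtype_mkQ (N : Submodule R A) : IsShortExact N.subtype N.mkQ :=
  ⟨N.injective_subtype, LinearMap.exact_subtype_mkQ N, N.mkQ_surjective⟩

theorem isShortExact_ker_subtype {g : B →ₗ[R] C} (hg : Function.Surjective g) :
    IsShortExact (LinearMap.ker g).subtype g :=
  ⟨Submodule.injective_subtype _, LinearMap.exact_subtype_ker_map g, hg⟩

theorem isShortExact_range_mkQ {f : A →ₗ[R] B} (hf : Function.Injective f) :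
    IsShortExact f (LinearMap.range f).mkQ :=
  ⟨hf, LinearMap.exact_map_mkQ_range f, Submodule.mkQ_surjective _⟩

theorem isShortExact_inl_snd : IsShortExact (LinearMap.inl R A B) (LinearMap.snd R A B) :=
  ⟨LinearMap.inl_injective, Function.Exact.inl_snd, LinearMap.snd_surjective⟩

theorem isShortExact_linearEquiv_zero [Subsingleton C] (e : A ≃ₗ[R] B) :
    IsShortExact e.toLinearMap (0 : B →ₗ[R] C) :=
  ⟨e.injective, (e.exact_zero_iff_surjective _).2 e.surjective, fun _ => ⟨0, Subsingleton.elim _ _⟩⟩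

variable {f : A →ₗ[R] B} {g : B →ₗ[R] C}

theorem IsShortExact.exists_comp_eq_smul (h : IsShortExact f g) {t : R}
    (ht : ∀ c : C, t • c = 0) :
    ∃ μ : B →ₗ[R] A, (∀ b, f (μ b) = t • b) ∧ ∀ a, μ (f a) = t • a := by
  have hmem (b : B) : t • b ∈ LinearMap.range f :=
    (h.exact (t • b)).1 (by rw [map_smul, ht])
  let e := LinearEquiv.ofInjective f h.injective
  let μ : B →ₗ[R] A := e.symm ∘ₗ (LinearMap.lsmul R B t).codRestrict _ hmem
  have hμ (b : B) : f (μ b) = t • b :=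
    congrArg Subtype.val (e.apply_symm_apply ⟨t • b, hmem b⟩)
  exact ⟨μ, hμ, fun a => h.injective (by rw [hμ, map_smul])⟩

theorem IsShortExact.lcomp (h : IsShortExact f g) {W : Type*} [AddCommGroup W] [Module R W]
    (hf : ∀ φ : A →ₗ[R] W, ∃ ψ : B →ₗ[R] W, ψ ∘ₗ f = φ) :
    IsShortExact (LinearMap.lcomp R W g) (LinearMap.lcomp R W f) :=
  ⟨LinearMap.lcomp_injective_of_surjective _ h.surjective,
    LinearMap.exact_lcomp_of_exact_of_surjective _ h.exact h.surjective, hf⟩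

end ShortExact

section Classes

variable {R : Type u} [CommRing R] {A B C : Type u} [AddCommGroup A] [AddCommGroup B]
  [AddCommGroup C] [Module R A] [Module R B] [Module R C] [Module.Finite R A] [Module.Finite R B]
  [Module.Finite R C]

theorem IsShortExact.cls_eq {f : A →ₗ[R] B} {g : B →ₗ[R] C} (h : IsShortExact f g) :
    cls R B = cls R A + cls R C := by
  have hG : G.mk R (FGModuleCat.of R B) =
      G.mk R (FGModuleCat.of R A) + G.mk R (FGModuleCat.of R C) := by
    rw [← sub_eq_zero, ← sub_sub, G.mk, G.mk, G.mk, ← map_sub, ← map_sub]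
    exact (QuotientAddGroup.eq_zero_iff _).2 (AddSubgroup.subset_closure
      ⟨FGModuleCat.of R A, FGModuleCat.of R B, FGModuleCat.of R C, f, g, h.injective, h.exact,
        h.surjective, rfl⟩)
  rw [cls, cls, cls, H.mk, hG, map_add, TensorProduct.tmul_add, H.mk, H.mk]

theorem cls_of_isPseudoZero (h : IsPseudoZero R A) : cls R A = 0 := by
  have hH : H.mk R (FGModuleCat.of R A) = 0 :=
    (QuotientAddGroup.eq_zero_iff _).2 (AddSubgroup.subset_closure ⟨FGModuleCat.of R A, h, rfl⟩)
  rw [cls, hH, TensorProduct.tmul_zero]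

theorem cls_of_subsingleton [Subsingleton A] : cls R A = 0 :=
  cls_of_isPseudoZero fun _ _ => inferInstance

theorem cls_congr (e : A ≃ₗ[R] B) : cls R A = cls R B := by
  rw [IsShortExact.cls_eq (C := PUnit.{u + 1}) (isShortExact_linearEquiv_zero e),
    cls_of_subsingleton (A := PUnit.{u + 1}), add_zero]

theorem cls_ker_add_range [IsNoetherianRing R] {B : Type u} [AddCommGroup B] [Module R B]
    (f : A →ₗ[R] B) :
    cls R A = cls R (LinearMap.ker f) + cls R (LinearMap.range f) :=
  (isShortExact_ker_subtype f.surjective_rangeRestrict).cls_eq |>.trans (by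
    rw [LinearMap.ker_rangeRestrict])

variable (R) in
theorem cls_fin_fun (n : ℕ) : cls R (Fin n → A) = n • cls R A := by
  induction n with
  | zero => rw [zero_smul]; exact cls_of_subsingleton
  | succ n ih =>
    rw [← cls_congr (Fin.consLinearEquiv R (fun _ : Fin (n + 1) => A)),
      isShortExact_inl_snd.cls_eq, ih, succ_nsmul']

theorem span_range_cls :
    Submodule.span ℝ {x : HR R | ∃ (M : Type u) (_ : AddCommGroup M) (_ : Module R M)
      (_ : Module.Finite R M), x = cls R M} = ⊤ := by
  refine Submodule.eq_top_iff'.2 fun x => ?_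
  induction x using TensorProduct.induction_on with
  | zero => exact zero_mem _
  | add x y hx hy => exact add_mem hx hy
  | tmul a h =>
    rw [← mul_one a, ← smul_eq_mul, ← TensorProduct.smul_tmul']
    refine Submodule.smul_mem _ _ ?_
    obtain ⟨g, rfl⟩ := QuotientAddGroup.mk_surjective h
    obtain ⟨g, rfl⟩ := QuotientAddGroup.mk_surjective g
    induction g using FreeAbelianGroup.induction_on with
    | zero =>
      rw [QuotientAddGroup.mk_zero, QuotientAddGroup.mk_zero, TensorProduct.tmul_zero]
      exact zero_mem _
    | of M => exact Submodule.subset_span ⟨M, inferInstance, inferInstance, inferInstance, rfl⟩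
    | neg M hM =>
      rw [QuotientAddGroup.mk_neg, QuotientAddGroup.mk_neg, TensorProduct.tmul_neg]
      exact neg_mem hM
    | add x y hx hy =>
      rw [QuotientAddGroup.mk_add, QuotientAddGroup.mk_add, TensorProduct.tmul_add]
      exact add_mem hx hy

end Classes

section PseudoIso

variable {R : Type u} [CommRing R] [IsNoetherianRing R] {A B : Type u} [AddCommGroup A]
  [AddCommGroup B] [Module R A] [Module R B]

/-- A pseudo-isomorphism is a homomorphism whose kernel and cokernel are pseudo-zero. -/
def IsPseudoIso (f : A →ₗ[R] B) : Prop :=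
  IsPseudoZero R (LinearMap.ker f) ∧ IsPseudoZero R (B ⧸ LinearMap.range f)

theorem IsPseudoIso.cls_eq [Module.Finite R A] [Module.Finite R B] {f : A →ₗ[R] B}
    (h : IsPseudoIso f) : cls R A = cls R B := by
  rw [cls_ker_add_range f, (isShortExact_subtype_mkQ (LinearMap.range f)).cls_eq,
    cls_of_isPseudoZero h.1, cls_of_isPseudoZero h.2, zero_add, add_zero]

end PseudoIso

section RealRank

variable (R : Type u) [CommRing R] [IsDomain R]

/-- The rank function on `h(R)_ℝ`. -/
noncomputable def rkR : HR R →ₗ[ℝ] ℝ :=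
  TensorProduct.AlgebraTensorModule.lift
    (LinearMap.toSpanSingleton ℝ (H R →ₗ[ℤ] ℝ)
      ((Int.castAddHom ℝ).comp (H.rk R)).toIntLinearMap)

theorem rkR_tmul (a : ℝ) (h : H R) : rkR R (a ⊗ₜ h) = a * H.rk R h := by
  simp [rkR]

theorem rk_mk (M : FGModuleCat.{u} R) : H.rk R (H.mk R M) = Module.finrank R M :=
  FreeAbelianGroup.lift_apply_of (fun M : FGModuleCat.{u} R => (Module.finrank R M : ℤ)) M

theorem rkR_cls (M : Type u) [AddCommGroup M] [Module R M] [Module.Finite R M] :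
    rkR R (cls R M) = Module.finrank R M := by
  simp [cls, rkR_tmul, rk_mk]

theorem rkR_cls_self : rkR R (cls R R) = 1 := by
  rw [rkR_cls, Module.finrank_self, Nat.cast_one]

theorem sub_rkR_smul_cls_mem_kR (x : HR R) : x - rkR R x • cls R R ∈ kR R := by
  induction x using TensorProduct.induction_on with
  | zero => simp
  | add x y hx hy =>
    rw [map_add, add_smul, add_sub_add_comm]
    exact add_mem hx hy
  | tmul a h =>
    have hmem : h - H.rk R h • H.mk R (FGModuleCat.of R R) ∈ kZ R := by
      change H.rk R _ = 0
      simp [rk_mk]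
    have heq : a ⊗ₜ[ℤ] h - rkR R (a ⊗ₜ[ℤ] h) • cls R R =
        a ⊗ₜ[ℤ] (h - H.rk R h • H.mk R (FGModuleCat.of R R)) := by
      rw [rkR_tmul, cls, TensorProduct.tmul_sub, TensorProduct.smul_tmul', smul_eq_mul, mul_one,
        TensorProduct.tmul_smul, TensorProduct.smul_tmul', zsmul_eq_mul, mul_comm]
    rw [heq]
    exact Submodule.tmul_mem_baseChange_of_mem _ hmem

theorem kR_eq_ker : kR R = LinearMap.ker (rkR R) := by
  refine le_antisymm ?_ fun x hx => ?_
  · rw [kR, Submodule.baseChange_eq_span, Submodule.span_le]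
    rintro x ⟨y, hy, rfl⟩
    have hy0 : H.rk R y = 0 := hy
    simp [rkR_tmul, hy0]
  · simpa [LinearMap.mem_ker.1 hx] using sub_rkR_smul_cls_mem_kR R x

end RealRank

/-! ### Torsion-free modules in height one -/

section HeightOne

theorem exists_comp_eq_smul_of_isLocalizedModule {R : Type*} [CommRing R] (S : Submonoid R)
    {M N M' N' : Type*} [AddCommGroup M] [AddCommGroup N] [AddCommGroup M'] [AddCommGroup N']
    [Module R M] [Module R N] [Module R M'] [Module R N'] [Module.FinitePresentation R M]
    [Module.FinitePresentation R N] (f : M →ₗ[R] M') (g : N →ₗ[R] N') [IsLocalizedModule S f]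
    [IsLocalizedModule S g] (hf : Function.Injective f) (hg : Function.Injective g)
    (e : M' ≃ₗ[R] N') :
    ∃ s ∈ S, ∃ (α : M →ₗ[R] N) (β : N →ₗ[R] M),
      (∀ m, β (α m) = s • m) ∧ ∀ n, α (β n) = s • n := by
  obtain ⟨α, s, hα⟩ :=
    Module.FinitePresentation.exists_lift_of_isLocalizedModule S g (e.toLinearMap ∘ₗ f)
  obtain ⟨β, t, hβ⟩ :=
    Module.FinitePresentation.exists_lift_of_isLocalizedModule S f (e.symm.toLinearMap ∘ₗ g)
  have hα' (m : M) : g (α m) = (s : R) • e (f m) := LinearMap.congr_fun hα m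
  have hβ' (n : N) : f (β n) = (t : R) • e.symm (g n) := LinearMap.congr_fun hβ n
  refine ⟨t * s, S.mul_mem t.2 s.2, α, β, fun m => hf ?_, fun n => hg ?_⟩
  · rw [hβ', hα', map_smul, e.symm_apply_apply, map_smul, mul_smul]
  · rw [hα', hβ', map_smul, e.apply_symm_apply, map_smul, mul_smul, smul_comm]

variable {R : Type u} [CommRing R] [IsNoetherianRing R] [IsDomain R]

theorem eq_of_le_of_height_le_one {q p : Ideal R} [q.IsPrime] [p.IsPrime] (hq : q ≠ ⊥)
    (hp : p.height ≤ 1) (h : q ≤ p) : q = p := by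
  by_contra hne
  have hlt := Ideal.height_strict_mono_of_isPrime_of_isPrime (lt_of_le_of_ne h hne)
  exact hq (Ideal.height_eq_zero_iff_eq_bot.1 (Order.lt_one_iff.1 (hlt.trans_le hp)))

variable [IsIntegrallyClosed R]

theorem isPrincipalIdealRing_localization {q : Ideal R} [q.IsPrime] (hq : q.height ≤ 1) :
    IsPrincipalIdealRing (Localization.AtPrime q) := by
  have hm : (IsLocalRing.maximalIdeal (Localization.AtPrime q)).height ≤ 1 := by
    rw [← WithBot.coe_le_coe, IsLocalRing.maximalIdeal_height_eq_ringKrullDim,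
      IsLocalization.AtPrime.ringKrullDim_eq_height q]
    exact_mod_cast hq
  have : IsNoetherianRing (Localization.AtPrime q) :=
    IsLocalization.isNoetherianRing q.primeCompl _ inferInstance
  have : IsDomain (Localization.AtPrime q) :=
    IsLocalization.isDomain_localization q.primeCompl_le_nonZeroDivisors
  have : IsIntegrallyClosed (Localization.AtPrime q) :=
    isIntegrallyClosed_of_isLocalization _ q.primeCompl q.primeCompl_le_nonZeroDivisors
  refine ((tfae_of_isNoetherianRing_of_isLocalRing_of_isDomain
    (Localization.AtPrime q)).out 3 0).1 ?_
  exact ⟨this, fun p hp0 hp =>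
      eq_of_le_of_height_le_one hp0 hm (IsLocalRing.le_maximalIdeal hp.ne_top)⟩

theorem exists_dvd_mul_of_mem {q : Ideal R} [q.IsPrime] (hq : q.height ≤ 1) :
    ∃ t ∈ q, ∀ u ∈ q, ∃ s ∉ q, t ∣ s * u := by
  obtain ⟨g, hg⟩ := ((isPrincipalIdealRing_localization hq).principal
    (IsLocalRing.maximalIdeal (Localization.AtPrime q))).principal
  obtain ⟨⟨t, c⟩, htc⟩ := IsLocalization.surj q.primeCompl g
  refine ⟨t, ?_, fun u hu => ?_⟩
  · rw [← IsLocalization.AtPrime.to_map_mem_maximal_iff (Localization.AtPrime q) q, ← htc]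
    exact Ideal.mul_mem_right _ _ (hg ▸ Submodule.mem_span_singleton_self g)
  · have hu' := (IsLocalization.AtPrime.to_map_mem_maximal_iff (Localization.AtPrime q) q u).2 hu
    rw [hg, Submodule.mem_span_singleton] at hu'
    obtain ⟨a, ha⟩ := hu'
    obtain ⟨⟨w, d⟩, hwd⟩ := IsLocalization.surj q.primeCompl a
    refine ⟨c * d, q.primeCompl.mul_mem c.2 d.2, w, ?_⟩
    apply IsLocalization.injective (Localization.AtPrime q) q.primeCompl_le_nonZeroDivisors
    rw [map_mul, map_mul, map_mul, ← ha, ← htc, ← hwd, smul_eq_mul]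
    ring

theorem exists_uniformizer {q : Ideal R} [q.IsPrime] (hq0 : q ≠ ⊥) (hq : q.height ≤ 1) :
    ∃ t ∈ q, t ≠ 0 ∧ ∃ s ∉ q, ∀ u ∈ q, t ∣ s * u := by
  obtain ⟨t, ht, hdvd⟩ := exists_dvd_mul_of_mem hq
  refine ⟨t, ht, ?_, ?_⟩
  · rintro rfl
    obtain ⟨u, hu, hu0⟩ := Submodule.exists_mem_ne_zero_of_ne_bot hq0
    obtain ⟨s, hs, hsu⟩ := hdvd u hu
    exact hs ((mul_eq_zero.1 (zero_dvd_iff.1 hsu)).resolve_right hu0 ▸ q.zero_mem)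
  · suffices h : ∀ I : Ideal R, I.FG → I ≤ q → ∃ s ∉ q, ∀ u ∈ I, t ∣ s * u from
      h q (IsNoetherian.noetherian q) le_rfl
    intro I hI
    induction I, hI using Submodule.fg_induction with
    | singleton x =>
      intro hx
      obtain ⟨s, hs, hsx⟩ := hdvd x (hx (Submodule.mem_span_singleton_self x))
      refine ⟨s, hs, fun u hu => ?_⟩
      obtain ⟨r, rfl⟩ := Submodule.mem_span_singleton.1 hu
      rw [smul_eq_mul, mul_left_comm]
      exact hsx.mul_left r
    | sup I J _ _ hI hJ =>
      intro hIJ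
      obtain ⟨a, ha, hdvdI⟩ := hI (le_sup_left.trans hIJ)
      obtain ⟨b, hb, hdvdJ⟩ := hJ (le_sup_right.trans hIJ)
      refine ⟨a * b, q.primeCompl.mul_mem ha hb, fun u hu => ?_⟩
      obtain ⟨v, hv, w, hw, rfl⟩ := Submodule.mem_sup.1 hu
      have hsum : a * b * (v + w) = b * (a * v) + a * (b * w) := by ring
      exact hsum ▸ dvd_add ((hdvdI v hv).mul_left b) ((hdvdJ w hw).mul_left a)

variable (M : Type u) [AddCommGroup M] [Module R M] [Module.Finite R M] [Module.IsTorsionFree R M]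
  (q : Ideal R) [q.IsPrime]

theorem nonempty_localizedModule_linearEquiv_fin_fun (hq : q.height ≤ 1) :
    Nonempty (LocalizedModule q.primeCompl M ≃ₗ[Localization.AtPrime q]
      (Fin (Module.finrank R M) → Localization.AtPrime q)) := by
  have := isPrincipalIdealRing_localization hq
  have hle : q.primeCompl ≤ nonZeroDivisors R := q.primeCompl_le_nonZeroDivisors
  have : IsDomain (Localization.AtPrime q) := IsLocalization.isDomain_localization hle
  have : Module.IsTorsionFree (Localization.AtPrime q) (LocalizedModule q.primeCompl M) :=
    IsLocalizedModule.isTorsionFree (LocalizedModule.mkLinearMap q.primeCompl M) q.primeCompl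
  refine ⟨LinearEquiv.ofFinrankEq _ _ ?_⟩
  rw [Module.finrank_fin_fun, IsLocalization.finrank_eq _ _ hle,
    IsLocalizedModule.finrank_eq _ (LocalizedModule.mkLinearMap q.primeCompl M) hle]

theorem exists_comp_eq_smul_of_height_le_one (hq : q.height ≤ 1) :
    ∃ s ∉ q, ∃ (α : M →ₗ[R] (Fin (Module.finrank R M) → R))
      (β : (Fin (Module.finrank R M) → R) →ₗ[R] M),
      (∀ m, β (α m) = s • m) ∧ ∀ v, α (β v) = s • v := by
  obtain ⟨e⟩ := nonempty_localizedModule_linearEquiv_fin_fun M q hq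
  have := Module.finitePresentation_of_finite R M
  let f : (Fin (Module.finrank R M) → R) →ₗ[R]
      (Fin (Module.finrank R M) → Localization.AtPrime q) :=
    LinearMap.pi fun i => Algebra.linearMap R (Localization.AtPrime q) ∘ₗ LinearMap.proj i
  have : IsLocalizedModule q.primeCompl f := IsLocalizedModule.pi q.primeCompl
    fun _ : Fin (Module.finrank R M) => Algebra.linearMap R (Localization.AtPrime q)
  refine exists_comp_eq_smul_of_isLocalizedModule q.primeCompl
    (LocalizedModule.mkLinearMap q.primeCompl M) f ?_ ?_ (e.restrictScalars R)
  · rw [IsLocalizedModule.injective_iff_isRegular (S := q.primeCompl)]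
    exact fun c => Module.IsTorsionFree.isSMulRegular (IsRegular.of_ne_zero
      (nonZeroDivisors.ne_zero (q.primeCompl_le_nonZeroDivisors c.2)))
  · exact fun v w h => funext fun i => IsLocalization.injective (Localization.AtPrime q)
      q.primeCompl_le_nonZeroDivisors (congrFun h i)

end HeightOne

/-! ### Classes of `Hom` modules -/

section PrimeAnnihilated

variable {R : Type u} [CommRing R] [IsNoetherianRing R] [IsDomain R] {q : Ideal R} [q.IsPrime]

theorem isPseudoZero_of_smul_eq_zero {N : Type u} [AddCommGroup N] [Module R N] (hq0 : q ≠ ⊥)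
    (hN : ∀ u ∈ q, ∀ n : N, u • n = 0) (h : q.height ≤ 1 → ∀ n : N, ∃ s ∉ q, s • n = 0) :
    IsPseudoZero R N := by
  refine fun p hp => LocalizedModule.subsingleton_iff.2 fun n => ?_
  by_cases hle : q ≤ p.asIdeal
  · obtain rfl := eq_of_le_of_height_le_one hq0 hp hle
    exact h hp n
  · obtain ⟨u, hu, hup⟩ := Set.not_subset.1 hle
    exact ⟨u, hup, hN u hu n⟩

theorem cls_eq_zero_of_one_lt_height {N : Type u} [AddCommGroup N] [Module R N]
    [Module.Finite R N] (hN : ∀ u ∈ q, ∀ n : N, u • n = 0) (hq : 1 < q.height) :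
    cls R N = 0 := by
  have hq0 : q ≠ ⊥ := by rintro rfl; simp at hq
  exact cls_of_isPseudoZero (isPseudoZero_of_smul_eq_zero hq0 hN fun h => (hq.not_ge h).elim)

variable {X Y Z : Type u} [AddCommGroup X] [AddCommGroup Y] [AddCommGroup Z] [Module R X]
  [Module R Y] [Module R Z] [Module.Finite R X] [Module.Finite R Y] [Module.Finite R Z]

theorem cls_eq_of_comp_eq_smul (hq0 : q ≠ ⊥) (hX : ∀ u ∈ q, ∀ x : X, u • x = 0)
    (hY : ∀ u ∈ q, ∀ y : Y, u • y = 0) (α : X →ₗ[R] Y) (β : Y →ₗ[R] X) {s : R} (hs : s ∉ q)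
    (hβα : ∀ x, β (α x) = s • x) (hαβ : ∀ y, α (β y) = s • y) : cls R X = cls R Y := by
  refine IsPseudoIso.cls_eq (f := α) ⟨isPseudoZero_of_smul_eq_zero hq0
    (fun u hu x => Subtype.ext (hX u hu x)) fun _ x => ⟨s, hs, Subtype.ext ?_⟩,
    isPseudoZero_of_smul_eq_zero hq0 (fun u hu y => ?_) fun _ y => ⟨s, hs, ?_⟩⟩
  · rw [Submodule.coe_smul, ← hβα, LinearMap.mem_ker.1 x.2, map_zero, Submodule.coe_zero]
  · obtain ⟨y, rfl⟩ := Submodule.mkQ_surjective _ y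
    rw [← map_smul, hY u hu, map_zero]
  · obtain ⟨y, rfl⟩ := Submodule.mkQ_surjective _ y
    rw [← map_smul, ← hαβ, Submodule.mkQ_apply, Submodule.Quotient.mk_eq_zero]
    exact LinearMap.mem_range_self α _

theorem cls_eq_add_of_exact_at_prime (hq0 : q ≠ ⊥) {ρ : X →ₗ[R] Y} {Φ : Y →ₗ[R] Z}
    (hρ : Function.Injective ρ) (hΦρ : ∀ x, Φ (ρ x) = 0)
    (hY : ∀ u ∈ q, ∀ y, u • y ∈ LinearMap.range ρ) (hZ : ∀ u ∈ q, ∀ z : Z, u • z = 0)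
    (hker : q.height ≤ 1 → ∀ y, Φ y = 0 → ∃ s ∉ q, s • y ∈ LinearMap.range ρ)
    (hrange : q.height ≤ 1 → ∀ z, ∃ s ∉ q, s • z ∈ LinearMap.range Φ) :
    cls R Y = cls R X + cls R Z := by
  let ρ' : X →ₗ[R] LinearMap.ker Φ := ρ.codRestrict _ hΦρ
  have hρ' : IsPseudoIso ρ' := by
    have hmem {s : R} {y : LinearMap.ker Φ} (h : s • (y : Y) ∈ LinearMap.range ρ) :
        s • (LinearMap.range ρ').mkQ y = 0 := by
      obtain ⟨x, hx⟩ := h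
      rw [← map_smul, Submodule.mkQ_apply, Submodule.Quotient.mk_eq_zero]
      exact ⟨x, Subtype.ext hx⟩
    have hinj : Function.Injective ρ' := fun _ _ h => hρ (congrArg Subtype.val h)
    refine ⟨fun p _ => ?_, isPseudoZero_of_smul_eq_zero hq0 (fun u hu y => ?_) fun hq y => ?_⟩
    · rw [LinearMap.ker_eq_bot.2 hinj]
      infer_instance
    · obtain ⟨y, rfl⟩ := Submodule.mkQ_surjective _ y
      exact hmem (hY u hu y)
    · obtain ⟨y, rfl⟩ := Submodule.mkQ_surjective _ y
      obtain ⟨s, hs, h⟩ := hker hq y y.2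
      exact ⟨s, hs, hmem h⟩
  have hΦ : IsPseudoZero R (Z ⧸ LinearMap.range Φ) := by
    refine isPseudoZero_of_smul_eq_zero hq0 (fun u hu z => ?_) fun hq z => ?_
    · obtain ⟨z, rfl⟩ := Submodule.mkQ_surjective _ z
      rw [← map_smul, hZ u hu, map_zero]
    · obtain ⟨z, rfl⟩ := Submodule.mkQ_surjective _ z
      obtain ⟨s, hs, h⟩ := hrange hq z
      exact ⟨s, hs, by rwa [← map_smul, Submodule.mkQ_apply, Submodule.Quotient.mk_eq_zero]⟩
  rw [cls_ker_add_range Φ, (isShortExact_subtype_mkQ (LinearMap.range Φ)).cls_eq, hρ'.cls_eq,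
    cls_of_isPseudoZero hΦ, add_zero]

end PrimeAnnihilated

theorem IsShortExact.exists_ker_comp {R A B C₁ C₂ C₃ : Type*} [CommRing R] [AddCommGroup A]
    [AddCommGroup B] [AddCommGroup C₁] [AddCommGroup C₂] [AddCommGroup C₃] [Module R A] [Module R B]
    [Module R C₁] [Module R C₂] [Module R C₃] {f : A →ₗ[R] B} {g : B →ₗ[R] C₂} {i : C₁ →ₗ[R] C₂}
    {π : C₂ →ₗ[R] C₃} (h : IsShortExact f g) (hC : IsShortExact i π) :
    ∃ (f' : A →ₗ[R] LinearMap.ker (π ∘ₗ g)) (g' : LinearMap.ker (π ∘ₗ g) →ₗ[R] C₁),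
      IsShortExact f' g' := by
  let e := LinearEquiv.ofInjective i hC.injective
  let g' : LinearMap.ker (π ∘ₗ g) →ₗ[R] C₁ :=
    e.symm ∘ₗ (g ∘ₗ Submodule.subtype _).codRestrict (LinearMap.range i)
      fun b => (hC.exact _).1 b.2
  have hg' (b) : i (g' b) = g b := congrArg Subtype.val (e.apply_symm_apply _)
  have hf (a : A) : (π ∘ₗ g) (f a) = 0 := by
    rw [LinearMap.comp_apply, h.exact.apply_apply_eq_zero, map_zero]
  refine ⟨f.codRestrict _ hf, g', fun a a' haa' => h.injective (congrArg Subtype.val haa'),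
    fun b => ?_, fun c => ?_⟩
  · rw [← map_eq_zero_iff i hC.injective, hg', h.exact b]
    exact ⟨fun ⟨a, ha⟩ => ⟨a, Subtype.ext ha⟩, fun ⟨a, ha⟩ => ⟨a, congrArg Subtype.val ha⟩⟩
  · obtain ⟨b, hb⟩ := h.surjective (i c)
    have hbk : (π ∘ₗ g) b = 0 := by
      rw [LinearMap.comp_apply, hb, hC.exact.apply_apply_eq_zero]
    exact ⟨⟨b, hbk⟩, hC.injective (by rw [hg', hb])⟩

section HomClass

variable {R : Type u} [CommRing R]

theorem exists_forall_smul_eq {B W : Type*} [AddCommGroup B] [Module R B] [AddCommGroup W]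
    [Module R W] {t : R} (ht : IsSMulRegular W t) (h : B →ₗ[R] W) (hh : ∀ b, ∃ w, t • w = h b) :
    ∃ g : B →ₗ[R] W, ∀ b, t • g b = h b := by
  choose g hg using hh
  refine ⟨⟨⟨g, fun x y => ht ?_⟩, fun r x => ht ?_⟩, hg⟩
  · simp only [smul_add, hg, map_add]
  · simp only [hg, map_smul, RingHom.id_apply, smul_comm t r]

theorem exists_smul_eq_smul_of_mem_smul_top {W : Type*} [AddCommGroup W] [Module R W] {q : Ideal R}
    {s t : R} (h : ∀ u ∈ q, t ∣ s * u) {w : W} (hw : w ∈ q • (⊤ : Submodule R W)) :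
    ∃ w', t • w' = s • w := by
  refine Submodule.smul_induction_on hw (fun u hu w _ => ?_) ?_
  · obtain ⟨r, hr⟩ := h u hu
    exact ⟨r • w, by rw [smul_smul, ← hr, mul_smul]⟩
  · rintro w₁ w₂ ⟨w₁', h₁⟩ ⟨w₂', h₂⟩
    exact ⟨w₁' + w₂', by rw [smul_add, smul_add, h₁, h₂]⟩

theorem smul_quotient_smul_top_eq_zero {W : Type*} [AddCommGroup W] [Module R W] {q : Ideal R}
    {u : R} (hu : u ∈ q) (w : W ⧸ q • (⊤ : Submodule R W)) : u • w = 0 := by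
  obtain ⟨w, rfl⟩ := Submodule.mkQ_surjective _ w
  rw [← map_smul, Submodule.mkQ_apply, Submodule.Quotient.mk_eq_zero]
  exact Submodule.smul_mem_smul hu trivial

theorem smul_quotient_eq_zero {q : Ideal R} {u : R} (hu : u ∈ q) (r : R ⧸ q) : u • r = 0 := by
  obtain ⟨r, rfl⟩ := Submodule.mkQ_surjective _ r
  rw [← map_smul, Submodule.mkQ_apply, Submodule.Quotient.mk_eq_zero]
  exact q.mul_mem_right r hu

section Restriction

variable {A B C W : Type*} [AddCommGroup A] [AddCommGroup B] [AddCommGroup C] [AddCommGroup W]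
  [Module R A] [Module R B] [Module R C] [Module R W] {f : A →ₗ[R] B} {t : R}

theorem IsShortExact.lcomp_injective {g : B →ₗ[R] C} (h : IsShortExact f g)
    (ht : ∀ c : C, t • c = 0) (htW : IsSMulRegular W t) :
    Function.Injective (LinearMap.lcomp R W f) := by
  obtain ⟨μ, hμ, -⟩ := h.exists_comp_eq_smul ht
  refine fun φ ψ hφψ => LinearMap.ext fun b => htW ?_
  simpa [hμ] using LinearMap.congr_fun hφψ (μ b)

theorem IsShortExact.smul_mem_range_lcomp {g : B →ₗ[R] C} (h : IsShortExact f g)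
    (ht : ∀ c : C, t • c = 0) (φ : A →ₗ[R] W) :
    t • φ ∈ LinearMap.range (LinearMap.lcomp R W f) := by
  obtain ⟨μ, -, hμ⟩ := h.exists_comp_eq_smul ht
  exact ⟨φ ∘ₗ μ, LinearMap.ext fun a => by simp [hμ]⟩

/-- `B` is generated by `A` and `x`, and the extension of `s • φ` to `B` sends `x` to
`t⁻¹ • s • φ (t • x)`. -/
theorem IsShortExact.smul_mem_range_lcomp_of_apply_mem {q : Ideal R} {g : B →ₗ[R] R ⧸ q}
    (h : IsShortExact f g) (ht : t ∈ q) (htW : IsSMulRegular W t) {s : R}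
    (hst : ∀ u ∈ q, t ∣ s * u) {x : B} (hx : g x = 1) {a : A} (ha : f a = t • x)
    {φ : A →ₗ[R] W} (hφ : φ a ∈ q • (⊤ : Submodule R W)) :
    s • φ ∈ LinearMap.range (LinearMap.lcomp R W f) := by
  obtain ⟨w, hw⟩ := exists_smul_eq_smul_of_mem_smul_top hst hφ
  obtain ⟨μ, hμ, hμf⟩ := h.exists_comp_eq_smul fun _ => smul_quotient_eq_zero ht _
  have hμx : μ x = a := h.injective (by rw [hμ, ha])
  have hdiv (b : B) : ∃ w, t • w = (s • φ ∘ₗ μ) b := by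
    obtain ⟨r, hr⟩ := Ideal.Quotient.mk_surjective (g b)
    obtain ⟨a', ha'⟩ := (h.exact (b - r • x)).1 (by
      rw [map_sub, map_smul, hx, ← hr, Algebra.smul_def, mul_one, Ideal.Quotient.algebraMap_eq,
        sub_self])
    refine ⟨s • φ a' + r • w, ?_⟩
    rw [← sub_add_cancel b (r • x), ← ha', LinearMap.smul_apply, LinearMap.comp_apply, map_add,
      hμf, map_smul, hμx, map_add, map_smul, map_smul, smul_add, smul_add, smul_comm t s,
      smul_comm t r, hw, smul_comm r s]
  obtain ⟨ψ, hψ⟩ := exists_forall_smul_eq htW _ hdiv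
  exact ⟨ψ, LinearMap.ext fun a' => htW (by simp [hψ, hμf, smul_comm s t])⟩

end Restriction

variable [IsNoetherianRing R] [IsDomain R] [IsIntegrallyClosed R]

theorem cls_quotient_smul_top (W : Type u) [AddCommGroup W] [Module R W] [Module.Finite R W]
    [Module.IsTorsionFree R W] {q : Ideal R} [q.IsPrime] (hq0 : q ≠ ⊥) :
    cls R (W ⧸ q • (⊤ : Submodule R W)) = Module.finrank R W • cls R (R ⧸ q) := by
  rw [← cls_fin_fun]
  have hW : ∀ u ∈ q, ∀ w : W ⧸ q • (⊤ : Submodule R W), u • w = 0 :=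
    fun _ => smul_quotient_smul_top_eq_zero
  have hR : ∀ u ∈ q, ∀ v : Fin (Module.finrank R W) → R ⧸ q, u • v = 0 :=
    fun _ hu v => funext fun i => smul_quotient_eq_zero hu (v i)
  rcases le_or_gt q.height 1 with hq | hq
  · obtain ⟨s, hs, α, β, hβα, hαβ⟩ := exists_comp_eq_smul_of_height_le_one W q hq
    let eW := TensorProduct.quotTensorEquivQuotSMul W q
    let eR := TensorProduct.piScalarRight R R (R ⧸ q) (Fin (Module.finrank R W))
    have hβα' : β ∘ₗ α = s • LinearMap.id := LinearMap.ext hβα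
    have hαβ' : α ∘ₗ β = s • LinearMap.id := LinearMap.ext hαβ
    refine cls_eq_of_comp_eq_smul hq0 hW hR
      (eR.toLinearMap ∘ₗ α.lTensor (R ⧸ q) ∘ₗ eW.symm.toLinearMap)
      (eW.toLinearMap ∘ₗ β.lTensor (R ⧸ q) ∘ₗ eR.symm.toLinearMap) hs (fun w => ?_) fun v => ?_
    · simp [← LinearMap.comp_apply (β.lTensor _), ← LinearMap.lTensor_comp, hβα']
    · simp [← LinearMap.comp_apply (α.lTensor _), ← LinearMap.lTensor_comp, hαβ']
  · rw [cls_eq_zero_of_one_lt_height hW hq, cls_eq_zero_of_one_lt_height hR hq]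

theorem exists_dual_apply_notMem {A : Type u} [AddCommGroup A] [Module R A] [Module.Finite R A]
    [Module.IsTorsionFree R A] {q : Ideal R} [q.IsPrime] (hq : q.height ≤ 1) {a : A}
    (ha : ∀ s ∉ q, s • a ∉ q • (⊤ : Submodule R A)) : ∃ ψ : Module.Dual R A, ψ a ∉ q := by
  obtain ⟨s, hs, α, β, hβα, -⟩ := exists_comp_eq_smul_of_height_le_one A q hq
  by_contra! hψ
  refine ha s hs ?_
  rw [← hβα, LinearMap.pi_apply_eq_sum_univ]
  exact Submodule.sum_mem _ fun i _ => Submodule.smul_mem_smul (hψ (LinearMap.proj i ∘ₗ α)) trivial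

variable {A B C W : Type u} [AddCommGroup A] [AddCommGroup B] [AddCommGroup C] [AddCommGroup W]
  [Module R A] [Module R B] [Module R C] [Module R W] [Module.Finite R A] [Module.Finite R B]
  [Module.Finite R C] [Module.Finite R W] [Module.IsTorsionFree R B] [Module.IsTorsionFree R W]

theorem IsShortExact.cls_hom_of_quotient_prime {q : Ideal R} [q.IsPrime] {f : A →ₗ[R] B}
    {g : B →ₗ[R] R ⧸ q} (h : IsShortExact f g) (hq0 : q ≠ ⊥) :
    cls R (A →ₗ[R] W) = cls R (B →ₗ[R] W) + Module.finrank R W • cls R (R ⧸ q) := by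
  have hA : Module.IsTorsionFree R A := h.injective.moduleIsTorsionFree _ (map_smul f)
  rw [← cls_quotient_smul_top W hq0]
  have hW {t : R} (ht0 : t ≠ 0) : IsSMulRegular W t := smul_right_injective W ht0
  have hρ : Function.Injective (LinearMap.lcomp R W f) := by
    obtain ⟨t, ht, ht0⟩ := Submodule.exists_mem_ne_zero_of_ne_bot hq0
    exact h.lcomp_injective (fun _ => smul_quotient_eq_zero ht _) (hW ht0)
  have hY : ∀ u ∈ q, ∀ φ : A →ₗ[R] W, u • φ ∈ LinearMap.range (LinearMap.lcomp R W f) :=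
    fun _ hu => h.smul_mem_range_lcomp fun _ => smul_quotient_eq_zero hu _
  have hZ : ∀ u ∈ q, ∀ w : W ⧸ q • (⊤ : Submodule R W), u • w = 0 :=
    fun _ => smul_quotient_smul_top_eq_zero
  rcases le_or_gt q.height 1 with hq | hq
  swap
  · exact cls_eq_add_of_exact_at_prime (Φ := 0) hq0 hρ (fun _ => rfl) hY hZ
      (fun hq' => (hq.not_ge hq').elim) fun hq' => (hq.not_ge hq').elim
  obtain ⟨t, ht, ht0, s, hs, hst⟩ := exists_uniformizer hq0 hq
  obtain ⟨x, hx⟩ := h.surjective 1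
  obtain ⟨a, ha⟩ := (h.exact (t • x)).1 (by rw [map_smul, smul_quotient_eq_zero ht])
  obtain ⟨ψ, hψ⟩ : ∃ ψ : Module.Dual R A, ψ a ∉ q := by
    refine exists_dual_apply_notMem hq fun r hr hmem => q.primeCompl.mul_mem hs hr ?_
    obtain ⟨a', ha'⟩ := exists_smul_eq_smul_of_mem_smul_top hst hmem
    have hfa' : f a' = (s * r) • x := smul_right_injective B ht0 (by
      simp only [← map_smul, ha']
      rw [map_smul, map_smul, ha, smul_smul, smul_comm, smul_smul])
    have hgx : (s * r) • g x = 0 := by rw [← map_smul, ← hfa', h.exact.apply_apply_eq_zero]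
    rwa [hx, Algebra.smul_def, mul_one, Ideal.Quotient.algebraMap_eq,
      Ideal.Quotient.eq_zero_iff_mem] at hgx
  refine cls_eq_add_of_exact_at_prime (Φ := Submodule.mkQ _ ∘ₗ LinearMap.applyₗ a) hq0 hρ
    (fun φ => ?_) hY hZ (fun _ φ hφ => ⟨s, hs, ?_⟩) fun _ w => ⟨ψ a, hψ, ?_⟩
  · have hφ : LinearMap.applyₗ a (LinearMap.lcomp R W f φ) = t • φ x := by simp [ha]
    rw [LinearMap.comp_apply, hφ, map_smul, smul_quotient_smul_top_eq_zero ht]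
  · exact h.smul_mem_range_lcomp_of_apply_mem ht (hW ht0) hst hx ha
      ((Submodule.Quotient.mk_eq_zero _).1 hφ)
  · obtain ⟨w, rfl⟩ := Submodule.mkQ_surjective _ w
    exact ⟨LinearMap.toSpanSingleton R W w ∘ₗ ψ, by simp⟩

theorem IsShortExact.cls_hom {f : A →ₗ[R] B} {g : B →ₗ[R] C} (h : IsShortExact f g)
    (hC : Module.IsTorsion R C) :
    cls R (A →ₗ[R] W) = cls R (B →ₗ[R] W) + Module.finrank R W • cls R C := by
  induction ‹Module.Finite R C› using
    IsNoetherianRing.induction_on_isQuotientEquivQuotientPrime R generalizing A B with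
  | subsingleton C =>
    have hf : Function.Surjective f := fun b => (h.exact b).1 (Subsingleton.elim _ _)
    rw [cls_of_subsingleton (A := C), smul_zero, add_zero]
    exact cls_congr ((LinearEquiv.ofBijective f ⟨h.injective, hf⟩).congrLeft W R)
  | quotient C p e =>
    obtain ⟨r, hr⟩ := @hC (e.symm 1)
    have hrp : (r : R) ∈ p.asIdeal := by
      rw [← Ideal.Quotient.eq_zero_iff_mem, ← Ideal.Quotient.algebraMap_eq,
        ← mul_one (algebraMap _ _ _), ← Algebra.smul_def, ← e.apply_symm_apply 1, ← map_smul]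
      exact (congrArg e hr).trans (map_zero e)
    have hp : p.asIdeal ≠ ⊥ := Submodule.ne_bot_iff _ |>.2 ⟨r, hrp, nonZeroDivisors.coe_ne_zero r⟩
    have he : IsShortExact f (e.toLinearMap ∘ₗ g) :=
      ⟨h.injective, h.exact.comp_injective e e.injective (map_zero e),
        e.surjective.comp h.surjective⟩
    rw [he.cls_hom_of_quotient_prime hp, cls_congr e]
  | exact C₁ C₂ C₃ i π hi hπ hiπ ih₁ ih₃ =>
    have hC₁ : Module.IsTorsion R C₁ := fun x => by
      obtain ⟨r, hr⟩ := @hC (i x)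
      exact ⟨r, hi (by rw [map_zero, ← hr]; exact map_smul i (r : R) x)⟩
    have hC₃ : Module.IsTorsion R C₃ := fun x => by
      obtain ⟨y, rfl⟩ := hπ x
      obtain ⟨r, hr⟩ := @hC y
      exact ⟨r, by rw [← map_zero π, ← hr]; exact (map_smul π (r : R) y).symm⟩
    obtain ⟨f', g', h₁⟩ := h.exists_ker_comp ⟨hi, hiπ, hπ⟩
    rw [ih₁ h₁ hC₁, ih₃ (isShortExact_ker_subtype (g := π ∘ₗ g) (hπ.comp h.surjective)) hC₃,
      IsShortExact.cls_eq ⟨hi, hiπ, hπ⟩, smul_add, add_assoc, add_comm (_ • cls R C₃)]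

variable (B W) in
/-- Compare `B` with a free submodule of the same rank. -/
theorem cls_hom :
    cls R (B →ₗ[R] W) + Module.finrank R W • cls R B =
      Module.finrank R B • (cls R W + Module.finrank R W • cls R R) := by
  obtain ⟨s, hs, α, β, hβα, hαβ⟩ := exists_comp_eq_smul_of_height_le_one B (⊥ : Ideal R) (by simp)
  have hs0 : s ≠ 0 := hs
  have hβ : Function.Injective β := fun v w h =>
    smul_right_injective _ hs0 (by simpa only [hαβ] using congrArg α h)
  have h := isShortExact_range_mkQ hβ
  have hC : Module.IsTorsion R (B ⧸ LinearMap.range β) := fun x => by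
    obtain ⟨b, rfl⟩ := Submodule.mkQ_surjective _ x
    refine ⟨⟨s, mem_nonZeroDivisors_of_ne_zero hs0⟩, ?_⟩
    rw [Submonoid.mk_smul, ← map_smul, ← hβα, h.exact.apply_apply_eq_zero]
  have hfree : cls R ((Fin (Module.finrank R B) → R) →ₗ[R] W) = Module.finrank R B • cls R W := by
    rw [← cls_congr ((Pi.basisFun R (Fin (Module.finrank R B))).constr R), cls_fin_fun]
  rw [smul_add, ← hfree, h.cls_hom hC, h.cls_eq, cls_fin_fun, smul_add, add_assoc,
    smul_comm (Module.finrank R W), add_comm (_ • _ • cls R R)]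

end HomClass

/-! ### Vanishing of `Ext` -/

section Ext

variable {R : Type u} [CommRing R] {A B C : Type u} [AddCommGroup A] [AddCommGroup B]
  [AddCommGroup C] [Module R A] [Module R B] [Module R C]

/-- The vanishing of `Ext^i(X, Y)`. -/
abbrev ExtVanishes (R : Type u) [CommRing R] (X Y : Type u) [AddCommGroup X] [AddCommGroup Y]
    [Module R X] [Module R Y] (i : ℕ) : Prop :=
  Subsingleton (Abelian.Ext (ModuleCat.of R X) (ModuleCat.of R Y) i)

section

variable (X : Type u) [AddCommGroup X] [Module R X]

theorem extVanishes_of_free [Module.Free R A] (i : ℕ) : ExtVanishes R A X (i + 1) := by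
  have : Projective (ModuleCat.of R A) := (IsProjective.iff_projective A).1 inferInstance
  exact Abelian.Ext.subsingleton_of_projective _ _ _

theorem extVanishes_of_subsingleton_right [Subsingleton A] (i : ℕ) : ExtVanishes R X A i := by
  refine subsingleton_of_forall_eq 0 fun x => ?_
  rw [← x.comp_mk₀_id, (ModuleCat.isZero_of_subsingleton (ModuleCat.of R A)).eq_zero_of_tgt (𝟙 _),
    Abelian.Ext.mk₀_zero, Abelian.Ext.comp_zero]

theorem extVanishes_of_subsingleton_left [Subsingleton A] (i : ℕ) : ExtVanishes R A X i := by
  refine subsingleton_of_forall_eq 0 fun x => ?_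
  rw [← x.mk₀_id_comp, (ModuleCat.isZero_of_subsingleton (ModuleCat.of R A)).eq_zero_of_tgt (𝟙 _),
    Abelian.Ext.mk₀_zero, Abelian.Ext.zero_comp]

end

variable {f : A →ₗ[R] B} {g : B →ₗ[R] C}

/-- The short complex in the category of modules given by a short exact sequence of modules. -/
abbrev IsShortExact.shortComplex (h : IsShortExact f g) : ShortComplex (ModuleCat.{u} R) :=
  ShortComplex.mk (ModuleCat.ofHom f) (ModuleCat.ofHom g)
    (by ext x; exact h.exact.apply_apply_eq_zero x)

theorem IsShortExact.shortExact (h : IsShortExact f g) : h.shortComplex.ShortExact where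
  exact := (ShortComplex.ShortExact.moduleCat_exact_iff_function_exact _).2 h.exact
  mono_f := (ModuleCat.mono_iff_injective _).2 h.injective
  epi_g := (ModuleCat.epi_iff_surjective _).2 h.surjective

variable {X : Type u} [AddCommGroup X] [Module R X] {i : ℕ}

theorem IsShortExact.extVanishes_covariant_left (h : IsShortExact f g) (hB : ExtVanishes R X B i)
    (hC : ∀ j, j + 1 = i → ExtVanishes R X C j) : ExtVanishes R X A i := by
  cases i with
  | zero =>
    have : Mono h.shortComplex.f := h.shortExact.mono_f
    exact (Abelian.Ext.postcomp_mk₀_injective_of_mono (ModuleCat.of R X)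
      h.shortComplex.f).subsingleton
  | succ i =>
    have := hC i rfl
    refine subsingleton_of_forall_eq 0 fun x => ?_
    obtain ⟨y, hy⟩ :=
      Abelian.Ext.covariant_sequence_exact₁ _ h.shortExact x (Subsingleton.elim _ _) rfl
    rw [← hy, Subsingleton.elim y 0, Abelian.Ext.zero_comp]

theorem IsShortExact.extVanishes_covariant_middle (h : IsShortExact f g)
    (hA : ExtVanishes R X A i) (hC : ExtVanishes R X C i) : ExtVanishes R X B i := by
  refine subsingleton_of_forall_eq 0 fun x => ?_
  obtain ⟨y, hy⟩ :=
    Abelian.Ext.covariant_sequence_exact₂ _ h.shortExact x (Subsingleton.elim _ _)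
  rw [← hy, Subsingleton.elim y 0, Abelian.Ext.zero_comp]

theorem IsShortExact.extVanishes_covariant_right (h : IsShortExact f g)
    (hB : ExtVanishes R X B i) (hA : ExtVanishes R X A (i + 1)) : ExtVanishes R X C i := by
  refine subsingleton_of_forall_eq 0 fun x => ?_
  obtain ⟨y, hy⟩ :=
    Abelian.Ext.covariant_sequence_exact₃ _ h.shortExact x rfl (Subsingleton.elim _ _)
  rw [← hy, Subsingleton.elim y 0, Abelian.Ext.zero_comp]

theorem IsShortExact.extVanishes_contravariant_left (h : IsShortExact f g)
    (hB : ExtVanishes R B X i) (hC : ExtVanishes R C X (i + 1)) : ExtVanishes R A X i := by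
  refine subsingleton_of_forall_eq 0 fun x => ?_
  obtain ⟨y, hy⟩ := Abelian.Ext.contravariant_sequence_exact₁ h.shortExact _ x (add_comm 1 i)
    (Subsingleton.elim _ _)
  rw [← hy, Subsingleton.elim y 0, Abelian.Ext.comp_zero]

theorem IsShortExact.extVanishes_contravariant_middle (h : IsShortExact f g)
    (hA : ExtVanishes R A X i) (hC : ExtVanishes R C X i) : ExtVanishes R B X i := by
  refine subsingleton_of_forall_eq 0 fun x => ?_
  obtain ⟨y, hy⟩ :=
    Abelian.Ext.contravariant_sequence_exact₂ h.shortExact _ x (Subsingleton.elim _ _)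
  rw [← hy, Subsingleton.elim y 0, Abelian.Ext.comp_zero]

theorem IsShortExact.extVanishes_contravariant_right (h : IsShortExact f g)
    (hA : ExtVanishes R A X i) (hB : ExtVanishes R B X (i + 1)) : ExtVanishes R C X (i + 1) := by
  refine subsingleton_of_forall_eq 0 fun x => ?_
  obtain ⟨y, hy⟩ := Abelian.Ext.contravariant_sequence_exact₃ h.shortExact _ x
    (Subsingleton.elim _ _) (add_comm 1 i)
  rw [← hy, Subsingleton.elim y 0, Abelian.Ext.comp_zero]

theorem IsShortExact.exists_comp_eq_of_extVanishes (h : IsShortExact f g)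
    (hC : ExtVanishes R C X 1) (φ : A →ₗ[R] X) : ∃ ψ : B →ₗ[R] X, ψ ∘ₗ f = φ := by
  obtain ⟨y, hy⟩ := Abelian.Ext.contravariant_sequence_exact₁ h.shortExact (ModuleCat.of R X)
    (Abelian.Ext.mk₀ (ModuleCat.ofHom φ)) (add_comm 1 0) (Subsingleton.elim _ _)
  obtain ⟨y, rfl⟩ := (Abelian.Ext.mk₀_bijective _ _).2 y
  rw [Abelian.Ext.mk₀_comp_mk₀] at hy
  exact ⟨y.hom, congrArg ModuleCat.Hom.hom ((Abelian.Ext.mk₀_bijective _ _).1 hy)⟩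

theorem extVanishes_congr_left (e : A ≃ₗ[R] B) (h : ExtVanishes R B X i) : ExtVanishes R A X i :=
  IsShortExact.extVanishes_contravariant_left (C := PUnit.{u + 1})
    (isShortExact_linearEquiv_zero e) h (extVanishes_of_subsingleton_left _ _)

end Ext

/-! ### Depth and Serre's conditions -/

section Depth

open RingTheory.Sequence IsLocalRing

variable {S : Type u} [CommRing S] [IsLocalRing S] {N : Type u} [AddCommGroup N] [Module S N]

theorem exists_isWeaklyRegular_of_le_depth {n : ℕ} (h : (n : ℕ∞) ≤ depth S N) :
    ∃ rs : List S, (∀ r ∈ rs, r ∈ maximalIdeal S) ∧ IsWeaklyRegular N rs ∧ n ≤ rs.length := by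
  by_contra! hlt
  have hn : 0 < n := by simpa using hlt [] (by simp) (IsWeaklyRegular.nil S N)
  have hle : depth S N ≤ ((n - 1 : ℕ) : ℕ∞) := iSup₂_le fun rs hrs => by
    exact_mod_cast Nat.le_sub_one_of_lt (hlt rs hrs.1 hrs.2)
  exact absurd (Nat.cast_le.1 (h.trans hle)) (by omega)

theorem depth_eq_top_of_subsingleton [Subsingleton N] : depth S N = ⊤ := by
  refine ENat.eq_top_iff_forall_ge.2 fun n => ?_
  refine le_iSup₂_of_le (List.replicate n (0 : S)) ⟨fun r hr => ?_, ⟨fun i hi => ?_⟩⟩ (by simp)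
  · rw [List.eq_of_mem_replicate hr]
    exact zero_mem _
  · exact fun x y _ => Subsingleton.elim _ _

variable [IsNoetherianRing S] [Module.Finite S N]

theorem natCast_le_depth_iff [Nontrivial N] (n : ℕ) :
    (n : ℕ∞) ≤ depth S N ↔ ∀ i < n, ExtVanishes S (ResidueField S) N i := by
  have hfin : Module.Finite S (ResidueField S) :=
    inferInstanceAs (Module.Finite S (S ⧸ maximalIdeal S))
  have hsupp : Module.support S (S ⧸ maximalIdeal S) =
      PrimeSpectrum.zeroLocus (maximalIdeal S) := by
    rw [Module.support_eq_zeroLocus, Ideal.annihilator_quotient]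
  have hlt : maximalIdeal S • (⊤ : Submodule S N) < ⊤ :=
    (Submodule.top_ne_ideal_smul_of_le_jacobson_annihilator
      (maximalIdeal_le_jacobson _)).symm.lt_top
  constructor
  · intro h i hi
    obtain ⟨rs, hrs, hwr, hn⟩ := exists_isWeaklyRegular_of_le_depth h
    have hreg := (isRegular_iff_isWeaklyRegular_of_subset_maximalIdeal hrs).2 hwr
    exact ModuleCat.subsingleton_ext_of_exists_isRegular (maximalIdeal S)
      (ModuleCat.of S (ResidueField S)) hsupp.le (ModuleCat.of S N) hlt rs hrs hreg i
      (hi.trans_le hn)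
  · intro h
    obtain ⟨rs, hn, hrs, hreg⟩ := ModuleCat.exists_isRegular_of_exists_subsingleton_ext
      (maximalIdeal S) n (ModuleCat.of S N) hlt (ModuleCat.of S (ResidueField S)) hsupp h
    exact hn ▸ le_iSup₂_of_le rs ⟨hrs, hreg.1⟩ le_rfl

theorem le_depth_iff (d : ℕ∞) :
    d ≤ depth S N ↔ ∀ i : ℕ, i < d → ExtVanishes S (ResidueField S) N i := by
  rcases subsingleton_or_nontrivial N with hN | hN
  · exact iff_of_true (le_top.trans_eq depth_eq_top_of_subsingleton.symm)
      fun i _ => extVanishes_of_subsingleton_right _ i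
  rw [← ENat.forall_natCast_le_iff_le]
  simp only [natCast_le_depth_iff]
  exact ⟨fun h i hi => h (i + 1) (Order.add_one_le_of_lt hi) i i.lt_succ_self,
    fun h n hn i hi => h i ((Nat.cast_lt.2 hi).trans_le hn)⟩

end Depth

section Serre

open IsLocalRing RingTheory.Sequence

variable {R : Type u} [CommRing R]

/-- Serre's condition `(Sₙ)` in the form `depth M_𝔭 ≥ min (height 𝔭) n` for all primes `𝔭`. -/
def SerreCondition (R : Type u) [CommRing R] (n : ℕ) (M : Type u) [AddCommGroup M] [Module R M] :
    Prop :=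
  ∀ p : PrimeSpectrum R, min p.asIdeal.height n ≤
    depth (Localization.AtPrime p.asIdeal) (LocalizedModule p.asIdeal.primeCompl M)

section

variable {A B C : Type u} [AddCommGroup A] [AddCommGroup B] [AddCommGroup C] [Module R A]
  [Module R B] [Module R C]

theorem IsShortExact.localizedModule {f : A →ₗ[R] B} {g : B →ₗ[R] C} (h : IsShortExact f g)
    (S : Submonoid R) : IsShortExact (LocalizedModule.map S f) (LocalizedModule.map S g) :=
  ⟨LocalizedModule.map_injective S f h.injective,
    fun x => LocalizedModule.map_exact S f g h.exact x,
    LocalizedModule.map_surjective S g h.surjective⟩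

/-- The vanishing of `Ext^i(k(𝔭), M_𝔭)` over the local ring `R_𝔭`. -/
abbrev LocalExtVanishes (p : PrimeSpectrum R) (M : Type u) [AddCommGroup M] [Module R M] (i : ℕ) :
    Prop :=
  ExtVanishes (Localization.AtPrime p.asIdeal) (ResidueField (Localization.AtPrime p.asIdeal))
    (LocalizedModule p.asIdeal.primeCompl M) i

theorem serreCondition_zero : SerreCondition R 0 A := fun p => by
  rw [Nat.cast_zero, min_zero]
  exact zero_le

theorem isMCM_of_subsingleton [Subsingleton A] : IsMCM R A := fun _ =>
  le_top.trans_eq depth_eq_top_of_subsingleton.symm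

variable [IsNoetherianRing R] [Module.Finite R A] [Module.Finite R B] [Module.Finite R C]

theorem le_depth_localizedModule_iff (p : PrimeSpectrum R) (d : ℕ∞) :
    d ≤ depth (Localization.AtPrime p.asIdeal) (LocalizedModule p.asIdeal.primeCompl A) ↔
      ∀ i : ℕ, i < d → LocalExtVanishes p A i := by
  have : IsNoetherianRing (Localization.AtPrime p.asIdeal) :=
    IsLocalization.isNoetherianRing p.asIdeal.primeCompl _ inferInstance
  have : Module.Finite (Localization.AtPrime p.asIdeal) (LocalizedModule p.asIdeal.primeCompl A) :=
    Module.Finite.of_isLocalizedModule p.asIdeal.primeCompl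
      (LocalizedModule.mkLinearMap p.asIdeal.primeCompl A)
  exact le_depth_iff d

theorem isMCM_iff :
    IsMCM R A ↔ ∀ (p : PrimeSpectrum R) (i : ℕ), i < p.asIdeal.height → LocalExtVanishes p A i :=
  forall_congr' fun p => le_depth_localizedModule_iff p _

theorem serreCondition_iff (n : ℕ) : SerreCondition R n A ↔
    ∀ (p : PrimeSpectrum R) (i : ℕ), i < p.asIdeal.height → i < n → LocalExtVanishes p A i :=
  forall_congr' fun p => (le_depth_localizedModule_iff p _).trans <| by
    simp only [lt_min_iff, Nat.cast_lt, and_imp]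

theorem isMCM_iff_forall_serreCondition : IsMCM R A ↔ ∀ n, SerreCondition R n A := by
  simp only [isMCM_iff, serreCondition_iff]
  exact ⟨fun h n p i hi _ => h p i hi, fun h p i hi => h (i + 1) p i hi i.lt_succ_self⟩

variable {f : A →ₗ[R] B} {g : B →ₗ[R] C}

theorem IsShortExact.serreCondition_succ (h : IsShortExact f g) {n : ℕ} (hB : IsMCM R B)
    (hC : SerreCondition R n C) : SerreCondition R (n + 1) A := by
  rw [isMCM_iff] at hB
  rw [serreCondition_iff] at hC ⊢
  rintro p i hi hin
  refine (h.localizedModule _).extVanishes_covariant_left (hB p i hi) ?_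
  rintro j rfl
  exact hC p j ((Nat.cast_lt.2 j.lt_succ_self).trans hi) (Nat.lt_of_succ_lt_succ hin)

theorem IsShortExact.isMCM_left (h : IsShortExact f g) (hB : IsMCM R B) (hC : IsMCM R C) :
    IsMCM R A := by
  rw [isMCM_iff] at hB hC ⊢
  intro p i hi
  refine (h.localizedModule _).extVanishes_covariant_left (hB p i hi) ?_
  rintro j rfl
  exact hC p j ((Nat.cast_lt.2 j.lt_succ_self).trans hi)

theorem IsShortExact.isMCM_middle (h : IsShortExact f g) (hA : IsMCM R A) (hC : IsMCM R C) :
    IsMCM R B := by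
  rw [isMCM_iff] at hA hC ⊢
  exact fun p i hi => (h.localizedModule _).extVanishes_covariant_middle (hA p i hi) (hC p i hi)

theorem isMCM_congr (e : A ≃ₗ[R] B) (hA : IsMCM R A) : IsMCM R B :=
  IsShortExact.isMCM_middle (C := PUnit.{u + 1}) (isShortExact_linearEquiv_zero e) hA
    isMCM_of_subsingleton

theorem isMCM_fin_fun (hA : IsMCM R A) (n : ℕ) : IsMCM R (Fin n → A) := by
  induction n with
  | zero => exact isMCM_of_subsingleton
  | succ n ih =>
    exact isMCM_congr (Fin.consLinearEquiv R (fun _ : Fin (n + 1) => A))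
      (isShortExact_inl_snd.isMCM_middle hA ih)

end

variable [IsNoetherianRing R] {A : Type u} [AddCommGroup A] [Module R A]

theorem notMem_associatedPrimes_of_one_le_depth (p : PrimeSpectrum R)
    (h : 1 ≤ depth (Localization.AtPrime p.asIdeal) (LocalizedModule p.asIdeal.primeCompl A)) :
    p.asIdeal ∉ associatedPrimes R A := by
  intro hp
  obtain ⟨-, b, hb⟩ := (isAssociatedPrime_iff ..).1 hp
  have hpb (s : R) : s ∈ p.asIdeal ↔ s • b = 0 := by
    rw [hb, Submodule.mem_colon_singleton, Submodule.mem_bot]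
  obtain ⟨rs, hrs, hreg, hlen⟩ := exists_isWeaklyRegular_of_le_depth (n := 1) h
  obtain ⟨y, rs, rfl⟩ := List.exists_cons_of_length_pos hlen
  obtain ⟨⟨c, d⟩, rfl⟩ := IsLocalization.mk'_surjective p.asIdeal.primeCompl y
  have hc : c ∈ p.asIdeal :=
    (IsLocalization.AtPrime.mk'_mem_maximal_iff _ p.asIdeal c d).1 (hrs _ List.mem_cons_self)
  have hcb : IsLocalization.mk' (Localization.AtPrime p.asIdeal) c d •
      (LocalizedModule.mk b 1 : LocalizedModule p.asIdeal.primeCompl A) = 0 := by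
    rw [← Localization.mk_eq_mk', LocalizedModule.mk_smul_mk, (hpb c).1 hc, LocalizedModule.zero_mk]
  have hb0 : LocalizedModule.mkLinearMap p.asIdeal.primeCompl A b = 0 :=
    ((isWeaklyRegular_cons_iff _ _ _).1 hreg).1 (hcb.trans (smul_zero _).symm)
  obtain ⟨s, hs⟩ := (IsLocalizedModule.eq_zero_iff p.asIdeal.primeCompl
    (LocalizedModule.mkLinearMap p.asIdeal.primeCompl A)).1 hb0
  exact s.2 ((hpb s).2 hs)

theorem IsMCM.isTorsionFree [IsDomain R] (hA : IsMCM R A) : Module.IsTorsionFree R A := by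
  refine ⟨fun {r} hr x y hxy => sub_eq_zero.1 ?_⟩
  by_contra ha
  obtain ⟨P, hP, haP⟩ := exists_le_isAssociatedPrime_of_isNoetherianRing R _ ha
  have hrP : r ∈ P := haP (by
    rw [Submodule.mem_colon_singleton, Submodule.mem_bot, smul_sub, sub_eq_zero]
    exact hxy)
  have hht : 1 ≤ P.height := by
    rw [Order.one_le_iff_ne_zero, Ne, Ideal.height_eq_zero_iff_eq_bot]
    rintro rfl
    exact hr.ne_zero hrP
  exact notMem_associatedPrimes_of_one_le_depth ⟨P, hP.isPrime⟩ (hht.trans (hA ⟨P, hP.isPrime⟩)) hP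

end Serre

/-! ### Maximal Cohen-Macaulay modules and finite injective dimension -/

section

open scoped Pointwise

theorem isShortExact_lsmul_mkQ {R : Type*} [CommRing R] {N : Type*} [AddCommGroup N] [Module R N]
    {x : R} (hx : IsSMulRegular N x) :
    IsShortExact (LinearMap.lsmul R N x) (x • ⊤ : Submodule R N).mkQ :=
  ⟨hx, LinearMap.exact_lsmul_mkQ_smul_top N x, Submodule.mkQ_surjective _⟩

end

section FiniteInjDim

open scoped Pointwise
open IsLocalRing RingTheory.Sequence

variable {R : Type u} [CommRing R]

theorem extVanishes_quotient_ofList {N W : Type u} [AddCommGroup N] [Module R N] [AddCommGroup W]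
    [Module R W] {n : ℕ} (hN : ∀ i, n < i → ExtVanishes R N W i) {rs : List R}
    (hrs : IsWeaklyRegular N rs) {i : ℕ} (hi : n + rs.length < i) :
    ExtVanishes R (N ⧸ (Ideal.ofList rs • ⊤ : Submodule R N)) W i := by
  induction rs generalizing N n with
  | nil => exact extVanishes_congr_left (Submodule.quotEquivOfEqBot _ (by simp)) (hN i hi)
  | cons x rs ih =>
    rw [isWeaklyRegular_cons_iff] at hrs
    refine extVanishes_congr_left (Submodule.quotOfListConsSMulTopEquivQuotSMulTopInner N x rs)
      (ih (n := n + 1) (fun i hi => ?_) hrs.2 (by rw [List.length_cons] at hi; omega))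
    obtain ⟨j, rfl⟩ := Nat.exists_eq_add_one_of_ne_zero (Nat.ne_zero_of_lt hi)
    exact (isShortExact_lsmul_mkQ hrs.1).extVanishes_contravariant_right (hN j (by omega))
      (hN (j + 1) (by omega))

variable [IsLocalRing R]

section

variable {N : Type u} [AddCommGroup N] [Module R N]

theorem depth_localizedModule_maximalIdeal_le :
    depth (Localization.AtPrime (maximalIdeal R))
      (LocalizedModule (maximalIdeal R).primeCompl N) ≤ depth R N := by
  have hunit : (maximalIdeal R).primeCompl ≤ IsUnit.submonoid R :=
    fun _ hs => notMem_maximalIdeal.1 hs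
  have : IsLocalization (maximalIdeal R).primeCompl R := IsLocalization.self hunit
  have : IsLocalizedModule (maximalIdeal R).primeCompl (LinearMap.id : N →ₗ[R] N) :=
    isLocalizedModule_id _ _ R
  let e := IsLocalization.atUnits R (S := Localization.AtPrime (maximalIdeal R)) _ hunit
  let f := IsLocalizedModule.linearEquiv (maximalIdeal R).primeCompl (LinearMap.id : N →ₗ[R] N)
    (LocalizedModule.mkLinearMap (maximalIdeal R).primeCompl N)
  refine iSup₂_le fun rs hrs => le_iSup₂_of_le (rs.map e.symm) ⟨?_, ?_⟩ (by rw [List.length_map])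
  · rintro _ hr
    obtain ⟨x, hx, rfl⟩ := List.mem_map.1 hr
    rw [← IsLocalization.AtPrime.to_map_mem_maximal_iff (Localization.AtPrime (maximalIdeal R))
      (maximalIdeal R), ← e.commutes, Algebra.algebraMap_self, RingHom.id_apply, e.apply_symm_apply]
    exact hrs.1 x hx
  · have hmap :
        (rs.map e.symm).map (algebraMap R (Localization.AtPrime (maximalIdeal R))) = rs := by
      rw [List.map_map]
      exact (List.map_congr_left fun r _ => e.apply_symm_apply r).trans (List.map_id rs)
    rw [f.isWeaklyRegular_congr,
      ← isWeaklyRegular_map_algebraMap_iff (Localization.AtPrime (maximalIdeal R)), hmap]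
    exact hrs.2

theorem IsMCM.height_maximalIdeal_le_depth (h : IsMCM R N) :
    (maximalIdeal R).height ≤ depth R N :=
  (h ⟨maximalIdeal R, inferInstance⟩).trans depth_localizedModule_maximalIdeal_le

variable [IsNoetherianRing R] [Module.Finite R N]

theorem IsMCM.exists_isRegular [Nontrivial N] (h : IsMCM R N) :
    ∃ rs : List R, (∀ r ∈ rs, r ∈ maximalIdeal R) ∧ IsRegular N rs ∧
      rs.length = (maximalIdeal R).height := by
  obtain ⟨n, hn⟩ := ENat.ne_top_iff_exists.1 (maximalIdeal R).height_lt_top_of_isPrime.ne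
  obtain ⟨rs, hmem, hrs, hlen⟩ := exists_isWeaklyRegular_of_le_depth (n := n)
    (hn.trans_le h.height_maximalIdeal_le_depth)
  have hreg := (isRegular_iff_isWeaklyRegular_of_subset_maximalIdeal hmem).2 hrs
  refine ⟨rs, hmem, hreg, le_antisymm ?_ (hn ▸ Nat.cast_le.2 hlen)⟩
  have hdim := (Module.supportDim_add_length_eq_supportDim_of_isRegular rs hreg).trans_le
    (Module.supportDim_le_ringKrullDim R N)
  have : Nontrivial (N ⧸ (Ideal.ofList rs • ⊤ : Submodule R N)) :=
    Submodule.Quotient.nontrivial_iff.2 hreg.2.symm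
  obtain ⟨d, hd⟩ := WithBot.ne_bot_iff_exists.1 (Module.supportDim_ne_bot_of_nontrivial R
    (N ⧸ (Ideal.ofList rs • ⊤ : Submodule R N)))
  rw [← hd, ← maximalIdeal_height_eq_ringKrullDim] at hdim
  exact le_add_self.trans (WithBot.coe_le_coe.1 hdim)

theorem exists_residueField_injective (h : Module.supportDim R N = 0) :
    ∃ f : ResidueField R →ₗ[R] N, Function.Injective f := by
  have : Nontrivial N := (Module.supportDim_ne_bot_iff_nontrivial R N).1 (by simp [h])
  obtain ⟨P, hP⟩ := associatedPrimes.nonempty R N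
  have hmem : (⟨P, hP.isPrime⟩ : PrimeSpectrum R) ∈ Module.support R N := by
    rw [Module.support_eq_zeroLocus, ← Submodule.annihilator_top]
    exact hP.annihilator_le
  rw [support_of_supportDim_eq_zero R N h] at hmem
  obtain rfl : P = maximalIdeal R := le_antisymm (le_maximalIdeal hP.isPrime.ne_top) hmem
  exact ((isAssociatedPrime_iff_exists_injective_linearMap _ _).1 hP).2

end

section

variable [IsNoetherianRing R] {W : Type u} [AddCommGroup W] [Module R W] [Module.Finite R W]

theorem extVanishes_of_quotSMulTop {N : Type u} [AddCommGroup N] [Module R N] [Module.Finite R N]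
    {x : R} (hx : x ∈ maximalIdeal R) (hreg : IsSMulRegular N x) (i : ℕ)
    (h : ExtVanishes R (QuotSMulTop x N) W (i + 1)) : ExtVanishes R N W i := by
  have hle : (⊤ : Submodule R (Abelian.Ext (ModuleCat.of R N) (ModuleCat.of R W) i)) ≤
      maximalIdeal R • ⊤ := by
    rintro y -
    obtain ⟨z, hz⟩ := Abelian.Ext.contravariant_sequence_exact₁
      (isShortExact_lsmul_mkQ hreg).shortExact _ y (add_comm 1 i) (h.elim _ _)
    change (Abelian.Ext.mk₀ (x • 𝟙 (ModuleCat.of R N))).comp z (zero_add i) = y at hz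
    rw [Abelian.Ext.mk₀_smul, Abelian.Ext.smul_comp, Abelian.Ext.mk₀_id_comp] at hz
    rw [← hz]
    exact Submodule.smul_mem_smul hx trivial
  have hbot := Submodule.eq_bot_of_le_smul_of_le_jacobson_bot _ _ Module.Finite.fg_top hle
    (maximalIdeal_le_jacobson _)
  exact (Submodule.subsingleton_iff R).1 (subsingleton_of_bot_eq_top hbot.symm)

theorem extVanishes_of_isWeaklyRegular {n : ℕ}
    (hn : ∀ (X : Type u) [AddCommGroup X] [Module R X] [Module.Finite R X] (i : ℕ), n < i →
      ExtVanishes R X W i) {N : Type u} [AddCommGroup N] [Module R N] [Module.Finite R N]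
    {rs : List R} (hmem : ∀ r ∈ rs, r ∈ maximalIdeal R) (hrs : IsWeaklyRegular N rs) {i : ℕ}
    (hi : n < i + rs.length) : ExtVanishes R N W i := by
  induction rs generalizing N i with
  | nil => exact hn N i hi
  | cons x rs ih =>
    rw [isWeaklyRegular_cons_iff] at hrs
    rw [List.forall_mem_cons] at hmem
    exact extVanishes_of_quotSMulTop hmem.1 hrs.1 i
      (ih hmem.2 hrs.2 (by rw [List.length_cons] at hi; omega))

theorem extVanishes_of_residueField {n : ℕ}
    (hn : ∀ (X : Type u) [AddCommGroup X] [Module R X] [Module.Finite R X],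
      ExtVanishes R X W (n + 1)) (hk : ExtVanishes R (ResidueField R) W n)
    (X : Type u) [AddCommGroup X] [Module R X] [hX : Module.Finite R X] :
    ExtVanishes R X W n := by
  refine IsNoetherianRing.induction_on_isQuotientEquivQuotientPrime R hX
    (motive := fun N _ _ _ => ExtVanishes R N W n)
    (fun N _ _ _ _ => extVanishes_of_subsingleton_left _ n) (fun N _ _ _ p e => ?_)
    (fun A _ _ _ B _ _ _ C _ _ _ f g hf hg hfg hA hC =>
      IsShortExact.extVanishes_contravariant_middle ⟨hf, hfg, hg⟩ hA hC)
  refine extVanishes_congr_left e ?_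
  by_cases hp : p.asIdeal = maximalIdeal R
  · rw [hp]
    exact hk
  · obtain ⟨x, hx, hxp⟩ := SetLike.exists_of_lt ((le_maximalIdeal p.2.ne_top).lt_of_ne hp)
    refine extVanishes_of_quotSMulTop hx (fun a b hab => ?_) n (hn _)
    refine mul_left_cancel₀ (mt Ideal.Quotient.eq_zero_iff_mem.1 hxp) ?_
    simpa only [Algebra.smul_def, Ideal.Quotient.algebraMap_eq] using hab

/-- By descending induction on `i`: the residue field embeds into the quotient of `R` by a maximal
regular sequence, which has projective dimension `height 𝔪`. -/
theorem FiniteInjDim.extVanishes_of_height_lt (hW : FiniteInjDim R W) (hR : IsCohenMacaulay R)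
    {i : ℕ} (hi : (maximalIdeal R).height < i) (X : Type u) [AddCommGroup X] [Module R X]
    [Module.Finite R X] : ExtVanishes R X W i := by
  obtain ⟨rs, -, hreg, hlen⟩ := IsMCM.exists_isRegular hR
  have hdim := Module.supportDim_add_length_eq_supportDim_of_isRegular rs hreg
  rw [Module.supportDim_self_eq_ringKrullDim, ← maximalIdeal_height_eq_ringKrullDim, ← hlen] at hdim
  obtain ⟨f, hf⟩ := exists_residueField_injective (R := R)
    (N := R ⧸ (Ideal.ofList rs • ⊤ : Submodule R R))
    (ENat.WithBot.add_natCast_cancel.1 (hdim.trans (zero_add _).symm))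
  rw [← hlen, Nat.cast_lt] at hi
  obtain ⟨n, hn⟩ := hW
  induction hk : n + 1 - i generalizing i X with
  | zero => exact HasInjectiveDimensionLT.subsingleton (ModuleCat.of R W) (n + 1) i (by omega) _
  | succ k ih =>
    have hsucc (X : Type u) [AddCommGroup X] [Module R X] [Module.Finite R X] :
        ExtVanishes R X W (i + 1) := ih X (by omega) (by omega)
    refine extVanishes_of_residueField hsucc
      ((isShortExact_range_mkQ hf).extVanishes_contravariant_left
      (extVanishes_quotient_ofList (fun i hi => ?_) hreg.1 (by rwa [zero_add])) (hsucc _)) X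
    obtain ⟨j, rfl⟩ := Nat.exists_eq_add_one_of_ne_zero hi.ne'
    exact extVanishes_of_free _ _

theorem FiniteInjDim.extVanishes_of_isMCM (hW : FiniteInjDim R W) (hR : IsCohenMacaulay R)
    {N : Type u} [AddCommGroup N] [Module R N] [Module.Finite R N] (hN : IsMCM R N) {i : ℕ}
    (hi : 0 < i) : ExtVanishes R N W i := by
  rcases subsingleton_or_nontrivial N with h | h
  · exact extVanishes_of_subsingleton_left _ _
  obtain ⟨rs, hmem, hreg, hlen⟩ := hN.exists_isRegular
  exact extVanishes_of_isWeaklyRegular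
    (fun X _ _ _ j hj => hW.extVanishes_of_height_lt hR (by rwa [← hlen, Nat.cast_lt]) X)
    hmem hreg.1 (Nat.lt_add_of_pos_left hi)

end

end FiniteInjDim

/-! ### Interior points of the cone -/

section Syzygies

variable {R : Type u} [CommRing R]

theorem SerreCondition.isMCM [IsLocalRing R] {N : Type u} [AddCommGroup N] [Module R N] {n : ℕ}
    (h : SerreCondition R n N) (hn : (IsLocalRing.maximalIdeal R).height ≤ n) : IsMCM R N :=
  fun p => (le_min le_rfl ((Ideal.height_mono (IsLocalRing.le_maximalIdeal p.2.ne_top)).trans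
    hn)).trans (h p)

variable [IsNoetherianRing R]

theorem exists_serreCondition_cls_eq (hR : IsCohenMacaulay R) (n : ℕ) (N : Type u)
    [AddCommGroup N] [Module R N] [Module.Finite R N] :
    ∃ (K : Type u) (_ : AddCommGroup K) (_ : Module R K) (_ : Module.Finite R K),
      SerreCondition R n K ∧ ∃ a : ℝ, cls R N = a • cls R R + (-1 : ℝ) ^ n • cls R K := by
  induction n with
  | zero => exact ⟨N, _, _, inferInstance, serreCondition_zero, 0, by simp⟩
  | succ n ih =>
    obtain ⟨K, _, _, _, hK, a, ha⟩ := ih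
    obtain ⟨b, π, hπ⟩ := Module.Finite.exists_fin' R K
    have h := isShortExact_ker_subtype hπ
    refine ⟨LinearMap.ker π, _, _, inferInstance,
      h.serreCondition_succ (isMCM_fin_fun hR b) hK, a + (-1) ^ n * b, ?_⟩
    have hcls := h.cls_eq
    rw [cls_fin_fun] at hcls
    rw [ha, eq_sub_of_add_eq' hcls.symm, pow_succ]
    module

variable [IsLocalRing R]

theorem exists_isMCM_cls_eq_add (hR : IsCohenMacaulay R) (N : Type u)
    [AddCommGroup N] [Module R N] [Module.Finite R N] :
    ∃ (K : Type u) (_ : AddCommGroup K) (_ : Module R K) (_ : Module.Finite R K),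
      IsMCM R K ∧ ∃ a : ℝ, cls R N = a • cls R R + cls R K := by
  obtain ⟨h, hh⟩ := ENat.ne_top_iff_exists.1
    (IsLocalRing.maximalIdeal R).height_lt_top_of_isPrime.ne
  obtain ⟨K, _, _, _, hK, a, ha⟩ := exists_serreCondition_cls_eq hR (2 * h) N
  refine ⟨K, _, _, inferInstance, hK.isMCM ?_, a, by simpa using ha⟩
  rw [← hh, Nat.cast_le]
  omega

theorem exists_isMCM_cls_eq_sub (hR : IsCohenMacaulay R) (N : Type u)
    [AddCommGroup N] [Module R N] [Module.Finite R N] :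
    ∃ (K : Type u) (_ : AddCommGroup K) (_ : Module R K) (_ : Module.Finite R K),
      IsMCM R K ∧ ∃ a : ℝ, cls R N = a • cls R R - cls R K := by
  obtain ⟨b, π, hπ⟩ := Module.Finite.exists_fin' R N
  obtain ⟨K, _, _, _, hK, a, ha⟩ := exists_isMCM_cls_eq_add hR (LinearMap.ker π)
  refine ⟨K, _, _, inferInstance, hK, b - a, ?_⟩
  have hcls := (isShortExact_ker_subtype hπ).cls_eq
  rw [cls_fin_fun, ha] at hcls
  rw [eq_sub_of_add_eq' hcls.symm]
  module

end Syzygies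

section OrderUnit

variable {V : Type*} [AddCommGroup V] [Module ℝ V]

/-- The vectors `x` such that `-a e ≤ x ≤ a e` for some `a ≥ 0`, in the preorder on `V` given by the
pointed cone `C`. The vector `e` is an order unit if these are all vectors. -/
def orderBounded (C : PointedCone ℝ V) (e : V) : Submodule ℝ V where
  carrier := {x | ∃ a : ℝ, 0 ≤ a ∧ a • e + x ∈ C ∧ a • e - x ∈ C}
  zero_mem' := ⟨0, le_rfl, by simp, by simp⟩
  add_mem' := by
    rintro x y ⟨a, ha, hx, hx'⟩ ⟨b, hb, hy, hy'⟩
    refine ⟨a + b, add_nonneg ha hb, ?_, ?_⟩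
    · convert add_mem hx hy using 1
      module
    · convert add_mem hx' hy' using 1
      module
  smul_mem' := by
    rintro t x ⟨a, ha, hx, hx'⟩
    refine ⟨|t| * a, by positivity, ?_⟩
    rcases le_total 0 t with ht | ht
    · rw [abs_of_nonneg ht, mul_smul, ← smul_add, ← smul_sub]
      exact ⟨C.smul_mem ht hx, C.smul_mem ht hx'⟩
    · have ht' := neg_nonneg.2 ht
      rw [abs_of_nonpos ht]
      constructor
      · convert C.smul_mem ht' hx' using 1
        module
      · convert C.smul_mem ht' hx using 1
        module

/-- The order interval `-e ≤ x ≤ e` in the preorder on `V` given by the pointed cone `C`. -/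
def orderInterval (C : PointedCone ℝ V) (e : V) : Set V :=
  {x | e + x ∈ C ∧ e - x ∈ C}

variable {C : PointedCone ℝ V} {e : V}

theorem convex_orderInterval : Convex ℝ (orderInterval C e) := by
  rintro x ⟨hx, hx'⟩ z ⟨hz, hz'⟩ a b ha hb hab
  obtain rfl := eq_sub_of_add_eq' hab
  constructor
  · convert add_mem (C.smul_mem ha hx) (C.smul_mem hb hz) using 1
    module
  · convert add_mem (C.smul_mem ha hx') (C.smul_mem hb hz') using 1
    module

theorem balanced_orderInterval : Balanced ℝ (orderInterval C e) := by
  rw [balanced_iff_neg_mem convex_orderInterval]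
  rintro x ⟨hx, hx'⟩
  exact ⟨by rwa [← sub_eq_add_neg], by rwa [sub_neg_eq_add]⟩

theorem absorbent_orderInterval (he : e ∈ C) (h : orderBounded C e = ⊤) :
    Absorbent ℝ (orderInterval C e) := by
  rw [absorbent_iff_eventually_nhdsNE_zero]
  intro x
  obtain ⟨a, ha, hx, hx'⟩ : x ∈ orderBounded C e := h ▸ Submodule.mem_top
  have ha1 : 0 < a + 1 := by positivity
  have hmem : (a + 1)⁻¹ • x ∈ orderInterval C e := by
    have hi := inv_nonneg.2 ha1.le
    constructor
    · convert C.smul_mem hi (add_mem hx he) using 1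
      match_scalars <;> field_simp
    · convert C.smul_mem hi (add_mem hx' he) using 1
      match_scalars <;> field_simp
  filter_upwards [mem_nhdsWithin_of_mem_nhds (Metric.ball_mem_nhds 0 (inv_pos.2 ha1))] with t ht
  have ht' : ‖t * (a + 1)‖ ≤ 1 := by
    rw [mem_ball_zero_iff, ← one_div, lt_div_iff₀ ha1] at ht
    rw [norm_mul, Real.norm_of_nonneg ha1.le]
    exact ht.le
  convert balanced_orderInterval.smul_mem ht' hmem using 1
  rw [smul_smul, mul_assoc, mul_inv_cancel₀ ha1.ne', mul_one]

variable [σ : TopologicalSpace V] [IsModuleTopology ℝ V]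

theorem continuous_seminorm (p : Seminorm ℝ V) : Continuous p := by
  let P : SeminormFamily ℝ V Unit := fun _ => p
  let τ : TopologicalSpace V := P.moduleFilterBasis.topology
  have hP : WithSeminorms (topology := τ) P := WithSeminorms.mk (topology := τ) rfl
  have : @IsTopologicalAddGroup V τ _ := hP.topologicalAddGroup
  have : @ContinuousSMul ℝ V _ _ τ := hP.continuousSMul
  have hle : σ ≤ τ :=
    (eq_moduleTopology ℝ V (τA := σ)).trans_le (moduleTopology_le ℝ V (τA := τ))
  exact continuous_le_dom hle (hP.continuous_seminorm ())

theorem smul_add_mem_interior (he : e ∈ C) (h : orderBounded C e = ⊤) {ε : ℝ} (hε : 0 < ε)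
    {y : V} (hy : y ∈ C) : ε • e + y ∈ interior (C : Set V) := by
  have habs := absorbent_orderInterval he h
  let p := gaugeSeminorm balanced_orderInterval convex_orderInterval habs
  have : IsTopologicalAddGroup V := IsModuleTopology.topologicalAddGroup ℝ V
  refine mem_interior.2 ⟨{z | p (z - (ε • e + y)) < ε}, fun z hz => ?_,
    isOpen_lt ((continuous_seminorm p).comp (by fun_prop)) continuous_const, by simpa using hε⟩
  obtain ⟨b, hb, hbε, u, ⟨hu, -⟩, hub⟩ := exists_lt_of_gauge_lt habs hz
  have hz : z = y + ((ε - b) • e + b • (e + u)) := by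
    rw [← sub_add_cancel z (ε • e + y), ← hub]
    module
  rw [hz]
  exact add_mem hy (add_mem (C.smul_mem (sub_nonneg.2 hbε.le) he) (C.smul_mem hb.le hu))

end OrderUnit

section Cone

variable {R : Type u} [CommRing R]

theorem cls_mem_c {M : Type u} [AddCommGroup M] [Module R M] [Module.Finite R M] (hM : IsMCM R M) :
    cls R M ∈ c R :=
  Submodule.subset_span ⟨M, _, _, inferInstance, hM, rfl⟩

variable [IsNoetherianRing R] [IsLocalRing R]

theorem orderBounded_c (hR : IsCohenMacaulay R) : orderBounded (c R) (cls R R) = ⊤ := by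
  have hRc : cls R R ∈ c R := cls_mem_c hR
  rw [eq_top_iff, ← span_range_cls, Submodule.span_le]
  rintro x ⟨N, _, _, _, rfl⟩
  obtain ⟨K, _, _, _, hK, a, ha⟩ := exists_isMCM_cls_eq_add hR N
  obtain ⟨K', _, _, _, hK', a', ha'⟩ := exists_isMCM_cls_eq_sub hR N
  refine ⟨|a| + |a'|, by positivity, ?_, ?_⟩
  · convert add_mem ((c R).smul_mem (by linarith [neg_abs_le a, abs_nonneg a'] :
      0 ≤ |a| + |a'| + a) hRc) (cls_mem_c hK) using 1
    rw [ha]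
    module
  · convert add_mem ((c R).smul_mem (by linarith [le_abs_self a', abs_nonneg a] :
      0 ≤ |a| + |a'| - a') hRc) (cls_mem_c hK') using 1
    rw [ha']
    module

theorem smul_cls_add_mem_interior_c (hR : IsCohenMacaulay R) {ε : ℝ} (hε : 0 < ε) {y : HR R}
    (hy : y ∈ c R) : ε • cls R R + y ∈ interior (c R : Set (HR R)) :=
  smul_add_mem_interior (cls_mem_c hR) (orderBounded_c hR) hε hy

end Cone

/-! ### The operator induced by `Hom(-, W)` -/

section HomMap

variable {R : Type u} [CommRing R]

/-- If `Ext^i(N, W) = 0` for all `i > 0`, dualizing a free resolution of `N` exhibits `Hom(N, W)` as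
an arbitrarily high syzygy of finite direct sums of copies of `W`. -/
theorem isMCM_hom_of_extVanishes [IsNoetherianRing R] {W : Type u} [AddCommGroup W] [Module R W]
    [Module.Finite R W] (hW : IsMCM R W) {N : Type u} [AddCommGroup N] [Module R N]
    [Module.Finite R N] (hN : ∀ i, 0 < i → ExtVanishes R N W i) : IsMCM R (N →ₗ[R] W) := by
  rw [isMCM_iff_forall_serreCondition]
  intro n
  induction n generalizing N with
  | zero => exact serreCondition_zero
  | succ n ih =>
    obtain ⟨b, π, hπ⟩ := Module.Finite.exists_fin' R N
    have h := isShortExact_ker_subtype hπ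
    have hK : ∀ i, 0 < i → ExtVanishes R (LinearMap.ker π) W i := by
      intro i hi
      obtain ⟨i, rfl⟩ := Nat.exists_eq_succ_of_ne_zero hi.ne'
      exact h.extVanishes_contravariant_left (extVanishes_of_free _ _) (hN _ (by omega))
    exact (h.lcomp (h.exists_comp_eq_of_extVanishes (hN 1 one_pos))).serreCondition_succ
      (isMCM_congr ((Pi.basisFun R (Fin b)).constr R) (isMCM_fin_fun hW b)) (ih hK)

/-- The endomorphism of `h(R)_ℝ` which maps `[N]` to `[Hom(N, W)]` for all finitely generated
torsion-free modules `N` over a noetherian normal domain `R`, if `W` is torsion-free: see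
`homMap_cls`. -/
noncomputable def homMap (R : Type u) [CommRing R] [IsDomain R] (W : Type u) [AddCommGroup W]
    [Module R W] [Module.Finite R W] : HR R →ₗ[ℝ] HR R :=
  (rkR R).smulRight (cls R W + (Module.finrank R W : ℝ) • cls R R) -
    (Module.finrank R W : ℝ) • LinearMap.id

variable [IsDomain R] (W : Type u) [AddCommGroup W] [Module R W] [Module.Finite R W]

theorem homMap_apply (x : HR R) : homMap R W x =
    rkR R x • (cls R W + (Module.finrank R W : ℝ) • cls R R) - (Module.finrank R W : ℝ) • x :=
  rfl

theorem homMap_of_mem_kR {x : HR R} (hx : x ∈ kR R) :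
    homMap R W x = -(Module.finrank R W : ℝ) • x := by
  rw [kR_eq_ker] at hx
  rw [homMap_apply, LinearMap.mem_ker.1 hx, zero_smul, zero_sub, neg_smul]

theorem homMap_cls_self : homMap R W (cls R R) = cls R W := by
  rw [homMap_apply, rkR_cls_self]
  module

theorem homMap_homMap (x : HR R) :
    homMap R W (homMap R W x) = (Module.finrank R W : ℝ) ^ 2 • x := by
  simp only [homMap_apply, map_sub, map_smul, map_add, rkR_cls R W, rkR_cls_self]
  module

theorem homMap_self_smul_add {t : HR R} (ht : t ∈ kR R) (a : ℝ) :
    homMap R R (a • cls R R + t) = a • cls R R - t := by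
  rw [map_add, map_smul, homMap_cls_self, homMap_of_mem_kR R ht, Module.finrank_self]
  module

variable [IsNoetherianRing R] [IsIntegrallyClosed R]

theorem homMap_cls [Module.IsTorsionFree R W] (N : Type u) [AddCommGroup N] [Module R N]
    [Module.Finite R N] [Module.IsTorsionFree R N] :
    homMap R W (cls R N) = cls R (N →ₗ[R] W) := by
  rw [homMap_apply, rkR_cls, Nat.cast_smul_eq_nsmul, Nat.cast_smul_eq_nsmul,
    Nat.cast_smul_eq_nsmul, ← cls_hom, add_sub_cancel_right]

variable {W} [IsLocalRing R]

theorem homMap_mem_c (hR : IsCohenMacaulay R) (hW : IsMCM R W) (hWi : FiniteInjDim R W)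
    {x : HR R} (hx : x ∈ c R) : homMap R W x ∈ c R := by
  have := hW.isTorsionFree
  induction hx using Submodule.span_induction with
  | mem x hx =>
    obtain ⟨N, _, _, _, hN, rfl⟩ := hx
    have := hN.isTorsionFree
    rw [homMap_cls]
    exact cls_mem_c (isMCM_hom_of_extVanishes hW fun i hi => hWi.extVanishes_of_isMCM hR hN hi)
  | zero => rw [map_zero]; exact zero_mem _
  | add x y _ _ hx hy => rw [map_add]; exact add_mem hx hy
  | smul t x _ hx =>
    rw [show homMap R W (t • x) = t • homMap R W x from (homMap R W).map_smul t.1 x]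
    exact Submodule.smul_mem _ t hx

theorem homMap_mem_closure_c (hR : IsCohenMacaulay R) (hW : IsMCM R W) (hWi : FiniteInjDim R W)
    {x : HR R} (hx : x ∈ closure (c R : Set (HR R))) :
    homMap R W x ∈ closure (c R : Set (HR R)) :=
  have : ContinuousAdd (HR R) := IsModuleTopology.toContinuousAdd ℝ (HR R)
  map_mem_closure (IsModuleTopology.continuous_of_linearMap (homMap R W)) hx
    fun _ hy => homMap_mem_c hR hW hWi hy

end HomMap

section ConeGeometry

variable {R : Type u} [CommRing R]

theorem isConvexCone_closure_c : IsConvexCone (closure (c R : Set (HR R))) := by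
  have : ContinuousAdd (HR R) := IsModuleTopology.toContinuousAdd ℝ (HR R)
  have : ContinuousSMul ℝ (HR R) := IsModuleTopology.toContinuousSMul ℝ (HR R)
  intro x hx y hy a b ha hb
  exact map_mem_closure₂ (f := fun x y : HR R => a • x + b • y) (by fun_prop) hx hy
    fun x hx y hy => add_mem ((c R).smul_mem ha hx) ((c R).smul_mem hb hy)

theorem rkR_nonneg_of_mem_c [IsDomain R] {x : HR R} (hx : x ∈ c R) : 0 ≤ rkR R x := by
  induction hx using Submodule.span_induction with
  | mem x hx =>
    obtain ⟨N, _, _, _, -, rfl⟩ := hx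
    rw [rkR_cls]
    positivity
  | zero => rw [map_zero]
  | add x y _ _ hx hy => rw [map_add]; exact add_nonneg hx hy
  | smul t x _ hx =>
    rw [show rkR R (t • x) = t * rkR R x from (rkR R).map_smul t.1 x]
    exact mul_nonneg t.2 hx

theorem rkR_nonneg_of_mem_closure_c [IsDomain R] {x : HR R}
    (hx : x ∈ closure (c R : Set (HR R))) : 0 ≤ rkR R x :=
  closure_minimal (t := {x | 0 ≤ rkR R x}) (fun _ => rkR_nonneg_of_mem_c)
    (isClosed_le continuous_const (IsModuleTopology.continuous_of_linearMap (rkR R))) hx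

variable [IsDomain R] [IsNoetherianRing R] [IsIntegrallyClosed R] [IsLocalRing R]

theorem isSymmetricAboutAxis_c (hR : IsCohenMacaulay R) (hG : IsGorenstein R) :
    IsSymmetricAboutAxis R (c R : Set (HR R)) := fun a t ht h => by
  rw [← homMap_self_smul_add ht]
  exact homMap_mem_c hR hR hG h

theorem isSymmetricAboutAxis_closure_c (hR : IsCohenMacaulay R) (hG : IsGorenstein R) :
    IsSymmetricAboutAxis R (closure (c R : Set (HR R))) := fun a t ht h => by
  rw [← homMap_self_smul_add ht]
  exact homMap_mem_closure_c hR hR hG h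

variable {W : Type u} [AddCommGroup W] [Module R W] [Module.Finite R W] [Nontrivial W]

/-- Up to a positive factor, `homMap R W` is an involution of the cone which exchanges the rays of
`[R]` and `[W]`. -/
theorem cls_mem_interior_c_of_finiteInjDim (hR : IsCohenMacaulay R) (hW : IsMCM R W)
    (hWi : FiniteInjDim R W) : cls R W ∈ interior (c R : Set (HR R)) := by
  have := hW.isTorsionFree
  have hr : (0 : ℝ) < Module.finrank R W := by exact_mod_cast Module.finrank_pos
  obtain ⟨a, ha, -, h⟩ : cls R W ∈ orderBounded (c R) (cls R R) :=
    orderBounded_c hR ▸ Submodule.mem_top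
  have ha1 : 0 < a + 1 := by positivity
  have hmem : (a + 1) • cls R W - (Module.finrank R W : ℝ) ^ 2 • cls R R ∈ c R := by
    have h' : (a + 1) • cls R R - cls R W ∈ c R := by
      convert add_mem h (cls_mem_c hR) using 1
      module
    have h'' := homMap_mem_c hR hW hWi h'
    rwa [map_sub, map_smul, homMap_cls_self, ← homMap_cls_self W, homMap_homMap,
      homMap_cls_self] at h''
  convert smul_cls_add_mem_interior_c hR
    (show 0 < (a + 1)⁻¹ * (Module.finrank R W : ℝ) ^ 2 by positivity)
    ((c R).smul_mem (inv_nonneg.2 ha1.le) hmem) using 1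
  match_scalars <;> field_simp
  ring

theorem neg_mem_closure_c_of_mem_kR (hR : IsCohenMacaulay R) (hW : IsMCM R W)
    (hWi : FiniteInjDim R W) {x : HR R} (hx : x ∈ closure (c R : Set (HR R))) (hxk : x ∈ kR R) :
    -x ∈ closure (c R : Set (HR R)) := by
  have := hW.isTorsionFree
  have hr : (0 : ℝ) < Module.finrank R W := by exact_mod_cast Module.finrank_pos
  have hmem := homMap_mem_closure_c hR hW hWi hx
  convert isConvexCone_closure_c _ hmem _ hmem (Module.finrank R W : ℝ)⁻¹ 0 (by positivity) le_rfl
    using 1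
  rw [homMap_of_mem_kR W hxk, zero_smul, add_zero, smul_smul, mul_neg, inv_mul_cancel₀ hr.ne',
    neg_one_smul]

theorem isStronglyConvexCone_closure_c_iff (hR : IsCohenMacaulay R) (hW : IsMCM R W)
    (hWi : FiniteInjDim R W) :
    IsStronglyConvexCone (closure (c R : Set (HR R))) ↔
      closure (c R : Set (HR R)) ∩ kR R = {0} := by
  have hinter : closure (c R : Set (HR R)) ∩ {x | -x ∈ closure (c R : Set (HR R))} =
      closure (c R : Set (HR R)) ∩ kR R := by
    ext x
    refine and_congr_right fun hx => ⟨fun hx' => ?_, neg_mem_closure_c_of_mem_kR hR hW hWi hx⟩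
    have hneg := rkR_nonneg_of_mem_closure_c hx'
    rw [map_neg, neg_nonneg] at hneg
    rw [kR_eq_ker]
    exact le_antisymm hneg (rkR_nonneg_of_mem_closure_c hx)
  rw [IsStronglyConvexCone, hinter, and_iff_right isConvexCone_closure_c]

end ConeGeometry

/-! ### Minimal complete resolutions -/

section MinimalFreeResolution

open IsLocalRing

variable {R : Type u} [CommRing R] [IsLocalRing R]

theorem exists_surjective_ker_apply_mem_maximalIdeal (N : Type u) [AddCommGroup N] [Module R N]
    [Module.Finite R N] : ∃ (b : ℕ) (π : (Fin b → R) →ₗ[R] N), Function.Surjective π ∧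
      ∀ v ∈ LinearMap.ker π, ∀ i, v i ∈ maximalIdeal R := by
  let β := Module.finBasis (ResidueField R) (ResidueField R ⊗[R] N)
  choose f hf using fun i =>
    TensorProduct.mk_surjective R N (ResidueField R) residue_surjective (β i)
  refine ⟨_, Fintype.linearCombination R f, ?_, fun v hv i => ?_⟩
  · rw [← LinearMap.range_eq_top, Fintype.range_linearCombination]
    exact span_eq_top_of_tmul_eq_basis f β hf
  · have hsum : ∑ j, residue R (v j) • β j = 0 := by
      rw [LinearMap.mem_ker, Fintype.linearCombination_apply] at hv
      rw [← map_zero (TensorProduct.mk R (ResidueField R) N 1), ← hv, map_sum]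
      refine Finset.sum_congr rfl fun j _ => ?_
      rw [map_smul, hf, ← algebraMap_smul (ResidueField R) (v j) (β j)]
      rfl
    exact (residue_eq_zero_iff _).1 (Fintype.linearIndependent_iff.1 β.linearIndependent _ hsum i)

/-- A minimal free resolution `⋯ → F₁ → F₀ → N → 0`, where `Fᵢ` is free of rank `b i`. -/
structure MinimalFreeResolution (R : Type u) [CommRing R] [IsLocalRing R] (N : Type u)
    [AddCommGroup N] [Module R N] where
  b : ℕ → ℕ
  d : ∀ i : ℕ, (Fin (b (i + 1)) → R) →ₗ[R] (Fin (b i) → R)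
  π : (Fin (b 0) → R) →ₗ[R] N
  surjective : Function.Surjective π
  exact_zero : Function.Exact (d 0) π
  exact_succ : ∀ i, Function.Exact (d (i + 1)) (d i)
  minimal : ∀ i v j, d i v j ∈ maximalIdeal R

theorem nonempty_minimalFreeResolution (R : Type u) [CommRing R] [IsLocalRing R]
    [IsNoetherianRing R] (N : Type u) [AddCommGroup N] [Module R N] [Module.Finite R N] :
    Nonempty (MinimalFreeResolution R N) := by
  obtain ⟨b₀, π, hπ, hmin⟩ := exists_surjective_ker_apply_mem_maximalIdeal (R := R) N
  choose b' p hp hpmin using fun (b : ℕ) (K : Submodule R (Fin b → R)) =>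
    exists_surjective_ker_apply_mem_maximalIdeal (R := R) K
  -- `s i` is the pair of the rank of `Fᵢ` and the kernel of the map out of `Fᵢ`.
  let s : ℕ → (b : ℕ) × Submodule R (Fin b → R) :=
    fun n => Nat.rec ⟨b₀, LinearMap.ker π⟩
      (fun _ t => ⟨b' t.1 t.2, LinearMap.ker (p t.1 t.2)⟩) n
  have hs : ∀ i, ∀ v ∈ (s i).2, ∀ j, v j ∈ maximalIdeal R := by
    rintro (_ | i)
    · exact hmin
    · exact hpmin _ _
  have hrange : ∀ i, LinearMap.range ((s i).2.subtype ∘ₗ p (s i).1 (s i).2) = (s i).2 := fun i => by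
    rw [LinearMap.range_comp_of_range_eq_top _ (LinearMap.range_eq_top.2 (hp _ _)),
      Submodule.range_subtype]
  refine ⟨⟨fun n => (s n).1, fun i => (s i).2.subtype ∘ₗ p (s i).1 (s i).2, π, hπ, ?_, ?_,
    fun i v j => hs i _ (p (s i).1 (s i).2 v).2 j⟩⟩
  · exact LinearMap.exact_iff.2 (hrange 0).symm
  · refine fun i => LinearMap.exact_iff.2 ?_
    refine .trans ?_ (hrange (i + 1)).symm
    rw [LinearMap.ker_comp, Submodule.ker_subtype]
    rfl

end MinimalFreeResolution

section Dual

variable {R : Type u} [CommRing R] {A B C : Type u} [AddCommGroup A] [AddCommGroup B]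
  [AddCommGroup C] [Module R A] [Module R B] [Module R C]

theorem exact_dualMap (f : A →ₗ[R] B) (g : B →ₗ[R] C) (h : Function.Exact f g)
    (hC : ExtVanishes R (C ⧸ LinearMap.range g) R 1) :
    Function.Exact g.dualMap f.dualMap := by
  intro φ
  refine ⟨fun hφ => ?_, ?_⟩
  · have hker : LinearMap.ker g ≤ LinearMap.ker φ := by
      intro x hx
      obtain ⟨y, rfl⟩ := (h x).1 hx
      exact LinearMap.congr_fun hφ y
    obtain ⟨ψ, hψ⟩ := (isShortExact_subtype_mkQ (LinearMap.range g)).exists_comp_eq_of_extVanishes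
      hC ((LinearMap.ker g).liftQ φ hker ∘ₗ g.quotKerEquivRange.symm.toLinearMap)
    refine ⟨ψ, LinearMap.ext fun x => ?_⟩
    simpa using LinearMap.congr_fun hψ (g.quotKerEquivRange (Submodule.Quotient.mk x))
  · rintro ⟨ψ, rfl⟩
    rw [← LinearMap.comp_apply, LinearMap.dualMap_comp_dualMap, h.linearMap_comp_eq_zero]
    exact ψ.comp_zero

open IsLocalRing

variable [IsLocalRing R] {N : Type u} [AddCommGroup N] [Module R N]

theorem MinimalFreeResolution.extVanishes_quotient (F : MinimalFreeResolution R N)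
    (hN : ∀ i, 0 < i → ExtVanishes R N R i) (i j : ℕ) (hj : 0 < j) :
    ExtVanishes R ((Fin (F.b i) → R) ⧸ LinearMap.range (F.d i)) R j := by
  induction i generalizing j with
  | zero =>
    exact extVanishes_congr_left (F.exact_zero.linearEquivOfSurjective F.surjective) (hN j hj)
  | succ i ih =>
    have e : ((Fin (F.b (i + 1)) → R) ⧸ LinearMap.range (F.d (i + 1))) ≃ₗ[R]
        LinearMap.range (F.d i) :=
      (Submodule.quotEquivOfEq _ _ (F.exact_succ i).linearMap_ker_eq.symm).trans
        (F.d i).quotKerEquivRange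
    obtain ⟨j, rfl⟩ := Nat.exists_eq_succ_of_ne_zero hj.ne'
    exact extVanishes_congr_left e
      ((isShortExact_subtype_mkQ (LinearMap.range (F.d i))).extVanishes_contravariant_left
        (extVanishes_of_free _ _) (ih _ (by omega)))

theorem MinimalFreeResolution.exact_dualMap_zero (F : MinimalFreeResolution R N) :
    Function.Exact F.π.dualMap (F.d 0).dualMap := by
  refine exact_dualMap _ _ F.exact_zero ?_
  rw [LinearMap.range_eq_top.2 F.surjective]
  exact extVanishes_of_subsingleton_left _ _

theorem MinimalFreeResolution.exact_dualMap_succ (F : MinimalFreeResolution R N)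
    (hN : ∀ i, 0 < i → ExtVanishes R N R i) (i : ℕ) :
    Function.Exact (F.d i).dualMap (F.d (i + 1)).dualMap :=
  exact_dualMap _ _ (F.exact_succ i) (F.extVanishes_quotient hN i 1 one_pos)

end Dual

section Transpose

variable {R : Type u} [CommRing R] {l m n : ℕ}

/-- The transpose of a linear map between standard free modules. -/
noncomputable def tr (δ : (Fin m → R) →ₗ[R] (Fin n → R)) : (Fin n → R) →ₗ[R] (Fin m → R) :=
  (dotProductEquiv R (Fin m)).symm.toLinearMap ∘ₗ δ.dualMap ∘ₗ
    (dotProductEquiv R (Fin n)).toLinearMap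

theorem dotProductEquiv_comp_tr (δ : (Fin m → R) →ₗ[R] (Fin n → R)) :
    (dotProductEquiv R (Fin m)).toLinearMap ∘ₗ tr δ =
      δ.dualMap ∘ₗ (dotProductEquiv R (Fin n)).toLinearMap := by
  ext; simp [tr]

theorem tr_dotProduct (δ : (Fin m → R) →ₗ[R] (Fin n → R)) (w : Fin n → R) (v : Fin m → R) :
    tr δ w ⬝ᵥ v = w ⬝ᵥ δ v :=
  LinearMap.congr_fun (LinearMap.congr_fun (dotProductEquiv_comp_tr δ) w) v

theorem dualMap_tr_comp_dotProductEquiv (δ : (Fin m → R) →ₗ[R] (Fin n → R)) :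
    (tr δ).dualMap ∘ₗ (dotProductEquiv R (Fin m)).toLinearMap =
      (dotProductEquiv R (Fin n)).toLinearMap ∘ₗ δ := by
  refine LinearMap.ext fun v => LinearMap.ext fun w => ?_
  change v ⬝ᵥ tr δ w = δ v ⬝ᵥ w
  rw [dotProduct_comm, tr_dotProduct, dotProduct_comm]

theorem exact_tr_iff (f : (Fin l → R) →ₗ[R] (Fin m → R)) (g : (Fin m → R) →ₗ[R] (Fin n → R)) :
    Function.Exact (tr g) (tr f) ↔ Function.Exact g.dualMap f.dualMap :=
  (Function.Exact.iff_of_ladder_linearEquiv (dotProductEquiv_comp_tr g).symm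
    (dotProductEquiv_comp_tr f).symm).symm

theorem exact_dualMap_tr_iff (f : (Fin l → R) →ₗ[R] (Fin m → R))
    (g : (Fin m → R) →ₗ[R] (Fin n → R)) :
    Function.Exact (tr f).dualMap (tr g).dualMap ↔ Function.Exact f g :=
  Function.Exact.iff_of_ladder_linearEquiv (f₁₂ := f) (f₂₃ := g)
    (g₁₂ := (tr f).dualMap) (g₂₃ := (tr g).dualMap) (dualMap_tr_comp_dotProductEquiv f)
    (dualMap_tr_comp_dotProductEquiv g)

theorem tr_apply_mem {I : Ideal R} (δ : (Fin m → R) →ₗ[R] (Fin n → R))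
    (h : ∀ v j, δ v j ∈ I) (w : Fin n → R) (i : Fin m) : tr δ w i ∈ I := by
  have := tr_dotProduct δ w (Pi.single i 1)
  rw [dotProduct_single, mul_one] at this
  rw [this]
  exact sum_mem fun j _ => I.mul_mem_left _ (h _ _)

end Transpose

section Gluing

theorem mem_smul_top_of_forall_mem {R : Type u} [CommRing R] {I : Ideal R} {n : ℕ} {v : Fin n → R}
    (hv : ∀ j, v j ∈ I) : v ∈ I • (⊤ : Submodule R (Fin n → R)) := by
  rw [pi_eq_sum_univ' v]
  exact sum_mem fun j _ => Submodule.smul_mem_smul (hv j) trivial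

open IsLocalRing

variable {R : Type u} [CommRing R] [IsLocalRing R] {M : Type u} [AddCommGroup M] [Module R M]
  (F : MinimalFreeResolution R M) (G : MinimalFreeResolution R (Module.Dual R M))

/-- The embedding of `M` into a free module defined by generators of `M*`. -/
noncomputable def glueEmbedding : M →ₗ[R] (Fin (G.b 0) → R) :=
  (dotProductEquiv R (Fin (G.b 0))).symm.toLinearMap ∘ₗ G.π.dualMap ∘ₗ Module.Dual.eval R M

theorem dotProduct_glueEmbedding (g : Fin (G.b 0) → R) (x : M) :
    g ⬝ᵥ glueEmbedding G x = G.π g x := by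
  rw [dotProduct_comm, ← dotProductEquiv_apply_apply]
  simp [glueEmbedding]

/-- The connecting map of a complete resolution. -/
noncomputable def glue : (Fin (F.b 0) → R) →ₗ[R] (Fin (G.b 0) → R) :=
  glueEmbedding G ∘ₗ F.π

theorem glueEmbedding_injective [Module.IsReflexive R M] :
    Function.Injective (glueEmbedding G) :=
  (dotProductEquiv R (Fin (G.b 0))).symm.injective.comp
    ((LinearMap.dualMap_injective_of_surjective G.surjective).comp
      (Module.bijective_dual_eval R M).1)

theorem exact_glue [Module.IsReflexive R M] : Function.Exact (F.d 0) (glue F G) :=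
  F.exact_zero.comp_injective _ (glueEmbedding_injective G) (map_zero _)

theorem exact_glue_tr [Module.IsReflexive R M] : Function.Exact (glue F G) (tr (G.d 0)) := by
  have h : Function.Surjective (Module.Dual.eval R M ∘ₗ F.π) :=
    (Module.bijective_dual_eval R M).2.comp F.surjective
  have h2 : Function.Exact (G.π.dualMap ∘ₗ (Module.Dual.eval R M ∘ₗ F.π)) (G.d 0).dualMap :=
    (Function.Surjective.comp_exact_iff_exact h).2 G.exact_dualMap_zero
  refine (Function.Exact.iff_of_ladder_linearEquiv (e₁ := LinearEquiv.refl _ _) ?_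
    (dotProductEquiv_comp_tr (G.d 0)).symm).1 h2
  ext
  simp [glue, glueEmbedding]

theorem dualMap_glue_comp : (glue F G).dualMap ∘ₗ (dotProductEquiv R (Fin (G.b 0))).toLinearMap =
    F.π.dualMap ∘ₗ G.π :=
  LinearMap.ext fun g => LinearMap.ext fun x => dotProduct_glueEmbedding G g (F.π x)

theorem exact_dualMap_glue : Function.Exact (glue F G).dualMap (F.d 0).dualMap := by
  have h : Function.Exact (F.π.dualMap ∘ₗ G.π) (F.d 0).dualMap :=
    (Function.Surjective.comp_exact_iff_exact G.surjective).2 F.exact_dualMap_zero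
  rw [← dualMap_glue_comp] at h
  exact (Function.Surjective.comp_exact_iff_exact (LinearEquiv.surjective _)).1 h

theorem exact_dualMap_tr_glue : Function.Exact (tr (G.d 0)).dualMap (glue F G).dualMap := by
  have h : Function.Exact (G.d 0) (F.π.dualMap ∘ₗ G.π) :=
    G.exact_zero.comp_injective _ (LinearMap.dualMap_injective_of_surjective F.surjective)
      (map_zero _)
  refine (Function.Exact.iff_of_ladder_linearEquiv (e₃ := LinearEquiv.refl _ _)
    (dualMap_tr_comp_dotProductEquiv (G.d 0)) ?_).2 h
  rw [dualMap_glue_comp]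
  rfl

theorem glue_apply_mem (hM : ¬ ∃ f : M →ₗ[R] R, Function.Surjective f) (x : Fin (F.b 0) → R)
    (i : Fin (G.b 0)) : glue F G x i ∈ maximalIdeal R := by
  by_contra hx
  have hu : IsUnit (glue F G x i) := by simpa using hx
  refine hM ⟨G.π (Pi.single i 1), fun r => ?_⟩
  obtain ⟨a, ha⟩ := hu.exists_left_inv
  refine ⟨(r * a) • F.π x, ?_⟩
  rw [map_smul, ← dotProduct_glueEmbedding, single_dotProduct, one_mul, smul_eq_mul, mul_assoc]
  change r * (a * glue F G x i) = r
  rw [ha, mul_one]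

theorem nonempty_minimalCompleteResolution [IsNoetherianRing R] [Module.Finite R M]
    (h : IsTotallyReflexive R M) (hM : ¬ ∃ f : M →ₗ[R] R, Function.Surjective f) :
    Nonempty (MinimalCompleteResolution R M) := by
  have := h.isReflexive
  obtain ⟨F⟩ := nonempty_minimalFreeResolution R M
  have hdual : Module.Finite R (Module.Dual R M) := inferInstance
  obtain ⟨G⟩ := nonempty_minimalFreeResolution R (Module.Dual R M)
  let b : ℤ → ℕ
    | .ofNat n => F.b n
    | .negSucc n => G.b n
  let d : ∀ i : ℤ, (Fin (b (i + 1)) → R) →ₗ[R] (Fin (b i) → R)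
    | .ofNat n => F.d n
    | .negSucc 0 => glue F G
    | .negSucc (n + 1) => tr (G.d n)
  refine ⟨⟨b, d, ?_, ?_, ?_, ?_⟩⟩
  · rintro (n | _ | _ | n)
    · exact F.exact_succ n
    · exact exact_glue F G
    · exact exact_glue_tr F G
    · exact (exact_tr_iff _ _).2 (G.exact_dualMap_succ h.ext_dual_eq_zero n)
  · rintro (n | _ | _ | n)
    · exact F.exact_dualMap_succ h.ext_eq_zero n
    · exact exact_dualMap_glue F G
    · exact exact_dualMap_tr_glue F G
    · exact (exact_dualMap_tr_iff _ _).2 (G.exact_succ n)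
  · rintro (n | _ | n) _ ⟨v, rfl⟩
    · exact mem_smul_top_of_forall_mem (F.minimal n v)
    · exact mem_smul_top_of_forall_mem (glue_apply_mem F G hM v)
    · exact mem_smul_top_of_forall_mem (tr_apply_mem (G.d n) (G.minimal n) v)
  · exact (LinearEquiv.ofInjective _ (glueEmbedding_injective G)).trans
      (LinearEquiv.ofEq _ (LinearMap.range (glue F G))
        (LinearMap.range_comp_of_range_eq_top _ (LinearMap.range_eq_top.2 F.surjective)).symm)

end Gluing

/-! ### Reflexivity of maximal Cohen-Macaulay modules -/

section Reflexive

variable {R : Type u} [CommRing R] {A B C M : Type u} [AddCommGroup A] [AddCommGroup B]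
  [AddCommGroup C] [AddCommGroup M] [Module R A] [Module R B] [Module R C] [Module R M]

theorem exists_eval_eq_smul_of_comp_eq_smul {L : Type*} [AddCommGroup L] [Module R L]
    [Module.IsReflexive R L] {α : M →ₗ[R] L} {β : L →ₗ[R] M} {s : R}
    (h : ∀ m, β (α m) = s • m) (φ : Module.Dual R (Module.Dual R M)) :
    ∃ m, Module.Dual.eval R M m = s • φ := by
  obtain ⟨v, hv⟩ := (Module.bijective_dual_eval R L).2 (α.dualMap.dualMap φ)
  refine ⟨β v, ?_⟩
  rw [← LinearMap.comp_apply, ← Module.Dual.eval_naturality, LinearMap.comp_apply, hv]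
  refine LinearMap.ext fun g => ?_
  have hg : g ∘ₗ β ∘ₗ α = s • g := LinearMap.ext fun m => by simp [h]
  change φ (g ∘ₗ β ∘ₗ α) = s • φ g
  rw [hg, map_smul]

section Noetherian

variable [IsNoetherianRing R] [Module.Finite R A] [Module.Finite R B] [Module.Finite R C]
  {f : A →ₗ[R] B} {g : B →ₗ[R] C}

theorem IsShortExact.subsingleton_right_of_isPseudoZero (h : IsShortExact f g)
    (hA : SerreCondition R 2 A) (hB : SerreCondition R 1 B) (hC : IsPseudoZero R C) :
    Subsingleton C := by
  by_contra hne
  rw [not_subsingleton_iff_nontrivial] at hne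
  obtain ⟨P, hP⟩ := associatedPrimes.nonempty R C
  obtain ⟨p, rfl⟩ : ∃ p : PrimeSpectrum R, p.asIdeal = P := ⟨⟨P, hP.isPrime⟩, rfl⟩
  refine notMem_associatedPrimes_of_one_le_depth p ?_ hP
  by_cases hp : p.asIdeal.height ≤ 1
  · have := hC p hp
    exact le_top.trans_eq depth_eq_top_of_subsingleton.symm
  · rw [not_le] at hp
    have hB0 : LocalExtVanishes p B 0 :=
      (serreCondition_iff 1).1 hB p 0 (zero_lt_one.trans hp) one_pos
    have hA1 : LocalExtVanishes p A 1 := (serreCondition_iff 2).1 hA p 1 hp one_lt_two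
    rw [le_depth_localizedModule_iff]
    intro i hi
    obtain rfl : i = 0 := by simpa using hi
    exact (h.localizedModule p.asIdeal.primeCompl).extVanishes_covariant_right hB0 hA1

theorem serreCondition_one_dual [Module.Finite R M] (hR : IsCohenMacaulay R) :
    SerreCondition R 1 (Module.Dual R M) := by
  obtain ⟨n, π, hπ⟩ := Module.Finite.exists_fin' R M
  exact (isShortExact_range_mkQ
    (LinearMap.dualMap_injective_of_surjective hπ)).serreCondition_succ
      (isMCM_congr (dotProductEquiv R (Fin n)) (isMCM_fin_fun hR n)) serreCondition_zero

end Noetherian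

variable [IsNoetherianRing R] [IsDomain R] [IsIntegrallyClosed R] [Module.Finite R M]

theorem eval_injective_of_isTorsionFree [Module.IsTorsionFree R M] :
    Function.Injective (Module.Dual.eval R M) := by
  obtain ⟨s, hs, α, β, hβα, -⟩ := exists_comp_eq_smul_of_height_le_one M (⊥ : Ideal R) (by simp)
  rw [injective_iff_map_eq_zero]
  intro m hm
  have hα : α m = 0 := by
    ext i
    exact LinearMap.congr_fun hm (LinearMap.proj i ∘ₗ α)
  refine (smul_eq_zero.1 ?_).resolve_left hs
  rw [← hβα, hα, map_zero]

theorem isPseudoZero_quotient_range_eval [Module.IsTorsionFree R M] :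
    IsPseudoZero R
      (Module.Dual R (Module.Dual R M) ⧸ LinearMap.range (Module.Dual.eval R M)) := by
  refine fun p hp => LocalizedModule.subsingleton_iff.2 fun x => ?_
  obtain ⟨φ, rfl⟩ := Submodule.mkQ_surjective _ x
  obtain ⟨s, hs, α, β, hβα, -⟩ := exists_comp_eq_smul_of_height_le_one M p.asIdeal hp
  refine ⟨s, hs, ?_⟩
  rw [← map_smul, Submodule.mkQ_apply, Submodule.Quotient.mk_eq_zero]
  exact exists_eval_eq_smul_of_comp_eq_smul hβα φ

/-- The cokernel of `M → M**` is pseudo-zero, while it has positive depth at all primes of height at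
least two since `M` satisfies `(S₂)`. -/
theorem IsMCM.isReflexive (hR : IsCohenMacaulay R) (hM : IsMCM R M) : Module.IsReflexive R M := by
  have := hM.isTorsionFree
  have hinj : Function.Injective (Module.Dual.eval R M) := eval_injective_of_isTorsionFree
  refine ⟨hinj, LinearMap.range_eq_top.1 (Submodule.Quotient.subsingleton_iff.1 ?_)⟩
  exact (isShortExact_range_mkQ hinj).subsingleton_right_of_isPseudoZero
    (isMCM_iff_forall_serreCondition.1 hM 2) (serreCondition_one_dual hR)
    isPseudoZero_quotient_range_eval

end Reflexive

/-! ### Syzygies in a minimal complete resolution -/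

section KComponent

variable {R : Type u} [CommRing R] {M N : Type u} [AddCommGroup M] [AddCommGroup N] [Module R M]
  [Module R N] [Module.Finite R M] [Module.Finite R N]

variable (R) in
/-- The component of `[N]` in `k(R)_ℝ` with respect to `h(R)_ℝ = ℝ[R] ⊕ k(R)_ℝ`. -/
noncomputable def kCls (N : Type u) [AddCommGroup N] [Module R N] [Module.Finite R N] : HR R :=
  cls R N - (Module.finrank R N : ℝ) • cls R R

theorem cls_eq_smul_add_kCls :
    cls R M = (Module.finrank R M : ℝ) • cls R R + kCls R M :=
  (add_sub_cancel _ _).symm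

theorem cls_mem_interior_c_of_finrank_lt [IsNoetherianRing R] [IsLocalRing R]
    (hR : IsCohenMacaulay R) (hN : IsMCM R N) (hlt : Module.finrank R N < Module.finrank R M)
    (hk : kCls R N = kCls R M) : cls R M ∈ interior (c R : Set (HR R)) := by
  have hpos : 0 < (Module.finrank R M : ℝ) - Module.finrank R N :=
    sub_pos.2 (by exact_mod_cast hlt)
  convert smul_cls_add_mem_interior_c hR hpos (cls_mem_c hN) using 1
  rw [cls_eq_smul_add_kCls (M := M), cls_eq_smul_add_kCls (M := N), hk]
  module

section Dual

variable [IsNoetherianRing R] [IsDomain R] [IsIntegrallyClosed R] [Module.IsTorsionFree R M]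

theorem finrank_dual : Module.finrank R (Module.Dual R M) = Module.finrank R M := by
  have h := congrArg (rkR R) (homMap_cls R M)
  rw [homMap_apply, map_sub, map_smul, map_smul, map_add, map_smul, rkR_cls_self, rkR_cls, rkR_cls,
    Module.finrank_self] at h
  refine Nat.cast_injective (R := ℝ) ?_
  simp only [smul_eq_mul, Nat.cast_one] at h
  linear_combination -h

theorem kCls_dual : kCls R (Module.Dual R M) = -kCls R M := by
  rw [kCls, kCls, finrank_dual, ← homMap_cls R M, homMap_apply, rkR_cls, Module.finrank_self]
  module

end Dual

end KComponent

section Syzygies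

variable {R : Type u} [CommRing R] [IsLocalRing R] {M : Type u} [AddCommGroup M] [Module R M]
  (F : MinimalCompleteResolution R M) (i : ℤ)

theorem isShortExact_range : IsShortExact (LinearMap.range (F.d (i + 1))).subtype
    (F.d i).rangeRestrict := by
  refine ⟨Submodule.injective_subtype _, LinearMap.exact_iff.2 ?_,
    LinearMap.surjective_rangeRestrict _⟩
  rw [LinearMap.ker_rangeRestrict, Submodule.range_subtype, (F.exact i).linearMap_ker_eq]

theorem kCls_range_succ [IsDomain R] :
    kCls R (LinearMap.range (F.d (i + 1))) = -kCls R (LinearMap.range (F.d i)) := by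
  have h := (isShortExact_range F i).cls_eq
  have hr := congrArg (rkR R) h
  rw [map_add, rkR_cls, rkR_cls, rkR_cls, Module.finrank_fin_fun] at hr
  rw [cls_fin_fun, ← Nat.cast_smul_eq_nsmul ℝ, hr] at h
  rw [kCls, kCls, ← add_eq_zero_iff_eq_neg, sub_add_sub_comm, ← add_smul, h, sub_self]

theorem kCls_range_eq_or_eq_neg [IsDomain R] [Module.Finite R M] :
    kCls R (LinearMap.range (F.d i)) = kCls R M ∨
      kCls R (LinearMap.range (F.d i)) = -kCls R M := by
  have h0 : kCls R (LinearMap.range (F.d (-1))) = kCls R M := by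
    rw [kCls, kCls, ← cls_congr F.iso, F.iso.finrank_eq]
  induction i using Int.inductionOn' (b := -1) with
  | zero => exact Or.inl h0
  | succ i _ ih =>
    rw [kCls_range_succ, neg_inj, neg_eq_iff_eq_neg]
    exact ih.symm
  | pred i _ ih =>
    obtain ⟨i, rfl⟩ : ∃ j, i = j + 1 := ⟨i - 1, by ring⟩
    rw [kCls_range_succ, neg_inj, neg_eq_iff_eq_neg] at ih
    rw [add_sub_cancel_right]
    exact ih.symm

variable [IsNoetherianRing R]

theorem isMCM_range (hR : IsCohenMacaulay R) : IsMCM R (LinearMap.range (F.d i)) := by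
  rw [isMCM_iff_forall_serreCondition]
  intro n
  induction n generalizing i with
  | zero => exact serreCondition_zero
  | succ n ih =>
    obtain ⟨i, rfl⟩ : ∃ j, i = j + 1 := ⟨i - 1, by ring⟩
    exact (isShortExact_range F i).serreCondition_succ (isMCM_fin_fun hR _) (ih i)

theorem isMCM_dual_range (hR : IsCohenMacaulay R) :
    IsMCM R (Module.Dual R (LinearMap.range (F.d i))) := by
  rw [isMCM_iff_forall_serreCondition]
  intro n
  induction n generalizing i with
  | zero => exact serreCondition_zero
  | succ n ih =>
    refine ((isShortExact_range F i).lcomp fun φ => ?_).serreCondition_succ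
      (isMCM_congr (dotProductEquiv R (Fin (F.b (i + 1)))) (isMCM_fin_fun hR _)) (ih (i + 1))
    have hφ : (F.d (i + 1 + 1)).dualMap (φ ∘ₗ (F.d (i + 1)).rangeRestrict) = 0 := by
      refine LinearMap.ext fun x => ?_
      have hx : (F.d (i + 1)).rangeRestrict (F.d (i + 1 + 1) x) = 0 :=
        Subtype.ext ((F.exact (i + 1)).apply_apply_eq_zero x)
      exact (congrArg φ hx).trans (map_zero φ)
    obtain ⟨ψ, hψ⟩ := (F.dual_exact (i + 1) _).1 hφ
    refine ⟨ψ, LinearMap.ext ?_⟩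
    rintro ⟨_, x, rfl⟩
    exact LinearMap.congr_fun hψ x

variable [Module.Finite R M]

theorem cls_mem_interior_c_of_surjective (hR : IsCohenMacaulay R) (hM : IsMCM R M) {f : M →ₗ[R] R}
    (hf : Function.Surjective f) : cls R M ∈ interior (c R : Set (HR R)) := by
  have h := isShortExact_ker_subtype hf
  rw [h.cls_eq, add_comm, ← one_smul ℝ (cls R R)]
  exact smul_cls_add_mem_interior_c hR one_pos (cls_mem_c (h.isMCM_left hM hR))

variable [IsDomain R] [IsIntegrallyClosed R]

theorem cls_mem_interior_c_of_finrank_range_lt (hR : IsCohenMacaulay R) [Module.IsTorsionFree R M]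
    (h : Module.finrank R (LinearMap.range (F.d i)) < Module.finrank R M) :
    cls R M ∈ interior (c R : Set (HR R)) ∧
      cls R (Module.Dual R M) ∈ interior (c R : Set (HR R)) := by
  have hZ := isMCM_range F i hR
  have hZd := isMCM_dual_range F i hR
  have := hZ.isTorsionFree
  rcases kCls_range_eq_or_eq_neg F i with hk | hk
  · exact ⟨cls_mem_interior_c_of_finrank_lt hR hZ h hk,
      cls_mem_interior_c_of_finrank_lt hR hZd (by rwa [finrank_dual, finrank_dual])
        (by rw [kCls_dual, kCls_dual, hk])⟩
  · exact ⟨cls_mem_interior_c_of_finrank_lt hR hZd (by rwa [finrank_dual])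
        (by rw [kCls_dual, hk, neg_neg]),
      cls_mem_interior_c_of_finrank_lt hR hZ (by rwa [finrank_dual]) (by rw [kCls_dual, hk])⟩

end Syzygies

section TotallyReflexive

variable {R : Type u} [CommRing R] [IsNoetherianRing R] {M : Type u} [AddCommGroup M] [Module R M]
  [Module.Finite R M]

theorem IsTotallyReflexive.isMCM (hR : IsCohenMacaulay R) (hM : IsTotallyReflexive R M) :
    IsMCM R M :=
  have := hM.isReflexive
  isMCM_congr (Module.evalEquiv R M).symm (isMCM_hom_of_extVanishes hR hM.ext_dual_eq_zero)

variable [IsDomain R] [IsIntegrallyClosed R] [IsLocalRing R]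

theorem IsMCM.isTotallyReflexive (hR : IsCohenMacaulay R) (hG : IsGorenstein R)
    (hM : IsMCM R M) : IsTotallyReflexive R M where
  isReflexive := hM.isReflexive hR
  ext_eq_zero _ hi := hG.extVanishes_of_isMCM hR hM hi
  ext_dual_eq_zero _ hi := hG.extVanishes_of_isMCM hR
    (isMCM_hom_of_extVanishes hR fun _ hj => hG.extVanishes_of_isMCM hR hM hj) hi

theorem IsTotallyReflexive.syzygyRanksGE (hR : IsCohenMacaulay R) (hM : IsTotallyReflexive R M)
    (h : cls R M ∈ frontier (c R : Set (HR R)) ∨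
      cls R (Module.Dual R M) ∈ frontier (c R : Set (HR R))) : SyzygyRanksGE R M := by
  have := (hM.isMCM hR).isTorsionFree
  have hint : ¬ (cls R M ∈ interior (c R : Set (HR R)) ∧
      cls R (Module.Dual R M) ∈ interior (c R : Set (HR R))) := fun hi =>
    h.elim (fun h => h.2 hi.1) (fun h => h.2 hi.2)
  refine ⟨nonempty_minimalCompleteResolution hM ?_, fun F i => ?_⟩
  · rintro ⟨f, hf⟩
    obtain ⟨x, hx⟩ := hf 1
    have hx' : Function.Surjective (Module.Dual.eval R M x) := fun r => ⟨r • f, by simp [hx]⟩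
    have hdual : IsMCM R (Module.Dual R M) := isMCM_hom_of_extVanishes hR hM.ext_eq_zero
    exact hint ⟨cls_mem_interior_c_of_surjective hR (hM.isMCM hR) hf,
      cls_mem_interior_c_of_surjective hR hdual hx'⟩
  · by_contra! hlt
    exact hint (cls_mem_interior_c_of_finrank_range_lt F (i - 1) hR hlt)

end TotallyReflexive

theorem IsCanonicalModule.nontrivial {R : Type u} [CommRing R] [IsLocalRing R] {ω : Type u}
    [AddCommGroup ω] [Module R ω] (hω : IsCanonicalModule R ω) : Nontrivial ω := by
  by_contra hn
  have := not_nontrivial_iff_subsingleton.1 hn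
  obtain ⟨d, -, ⟨e⟩⟩ := hω.type_one
  have h : ExtVanishes R (IsLocalRing.ResidueField R) ω d := extVanishes_of_subsingleton_right _ d
  exact not_subsingleton (IsLocalRing.ResidueField R) e.symm.injective.subsingleton

end CMCone

theorem theorem1p1_general (R : Type u) [CommRing R] [IsNoetherianRing R] [IsLocalRing R]
    [IsDomain R] [IsIntegrallyClosed R] (hR : CMCone.IsCohenMacaulay R)
    (W : Type u) [AddCommGroup W] [Module R W] [Module.Finite R W] [Nontrivial W]
    (hW : CMCone.IsMCM R W) (hWi : CMCone.FiniteInjDim R W) :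
    (CMCone.cls R R ∈ interior (CMCone.c R : Set (CMCone.HR R)) ∧
      CMCone.cls R W ∈ interior (CMCone.c R : Set (CMCone.HR R))) ∧
    (CMCone.IsStronglyConvexCone (closure (CMCone.c R : Set (CMCone.HR R))) ↔
      closure (CMCone.c R : Set (CMCone.HR R)) ∩ CMCone.kR R = {0}) ∧
    (CMCone.IsGorenstein R →
      (CMCone.IsSymmetricAboutAxis R (CMCone.c R : Set (CMCone.HR R)) ∧
        CMCone.IsSymmetricAboutAxis R (closure (CMCone.c R : Set (CMCone.HR R)))) ∧
      ∀ (M : Type u) [AddCommGroup M] [Module R M] [Module.Finite R M], CMCone.IsMCM R M →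
        (CMCone.cls R M ∈ frontier (CMCone.c R : Set (CMCone.HR R)) ∨
          CMCone.cls R (Module.Dual R M) ∈ frontier (CMCone.c R : Set (CMCone.HR R))) →
        CMCone.SyzygyRanksGE R M) ∧
    (∀ (M : Type u) [AddCommGroup M] [Module R M] [Module.Finite R M],
      CMCone.IsTotallyReflexive R M →
      (CMCone.cls R M ∈ frontier (CMCone.c R : Set (CMCone.HR R)) ∨
        CMCone.cls R (Module.Dual R M) ∈ frontier (CMCone.c R : Set (CMCone.HR R))) →
      CMCone.SyzygyRanksGE R M) := by
  refine ⟨⟨?_, CMCone.cls_mem_interior_c_of_finiteInjDim hR hW hWi⟩,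
    CMCone.isStronglyConvexCone_closure_c_iff hR hW hWi, fun hG => ⟨⟨?_, ?_⟩, ?_⟩, ?_⟩
  · simpa using CMCone.smul_cls_add_mem_interior_c hR one_pos (zero_mem (CMCone.c R))
  · exact CMCone.isSymmetricAboutAxis_c hR hG
  · exact CMCone.isSymmetricAboutAxis_closure_c hR hG
  · exact fun M _ _ _ hM h => (hM.isTotallyReflexive hR hG).syzygyRanksGE hR h
  · exact fun M _ _ _ hM h => hM.syzygyRanksGE hR h

theorem theorem1p1 (R : Type u) [CommRing R] [IsNoetherianRing R] [IsLocalRing R]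
    [IsDomain R] [IsIntegrallyClosed R] (hR : CMCone.IsCohenMacaulay R)
    (ω : Type u) [AddCommGroup ω] [Module R ω] [Module.Finite R ω]
    (hω : CMCone.IsCanonicalModule R ω)
    (hfin : Module.Finite ℝ (CMCone.HR R)) :
    -- interior points
    (CMCone.cls R R ∈ interior (CMCone.c R : Set (CMCone.HR R)) ∧
      CMCone.cls R ω ∈ interior (CMCone.c R : Set (CMCone.HR R))) ∧
    -- strong convexity of the closure
    (CMCone.IsStronglyConvexCone (closure (CMCone.c R : Set (CMCone.HR R))) ↔
      closure (CMCone.c R : Set (CMCone.HR R)) ∩ CMCone.kR R = {0}) ∧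
    -- the Gorenstein case
    (CMCone.IsGorenstein R →
      (CMCone.IsSymmetricAboutAxis R (CMCone.c R : Set (CMCone.HR R)) ∧
        CMCone.IsSymmetricAboutAxis R (closure (CMCone.c R : Set (CMCone.HR R)))) ∧
      ∀ (M : Type u) [AddCommGroup M] [Module R M] [Module.Finite R M], CMCone.IsMCM R M →
        (CMCone.cls R M ∈ frontier (CMCone.c R : Set (CMCone.HR R)) ∨
          CMCone.cls R (Module.Dual R M) ∈ frontier (CMCone.c R : Set (CMCone.HR R))) →
        CMCone.SyzygyRanksGE R M) ∧
    -- totally reflexive modules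
    (∀ (M : Type u) [AddCommGroup M] [Module R M] [Module.Finite R M],
      CMCone.IsTotallyReflexive R M →
      (CMCone.cls R M ∈ frontier (CMCone.c R : Set (CMCone.HR R)) ∨
        CMCone.cls R (Module.Dual R M) ∈ frontier (CMCone.c R : Set (CMCone.HR R))) →
      CMCone.SyzygyRanksGE R M) := by
  have := hω.nontrivial
  exact theorem1p1_general R hR ω hω.isMCM hω.finiteInjDim
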